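/- Let $d\ge 2$ be an integer and let $\varepsilon\in(0,1]$. Definitions. For a finite set $P\subset\mathbb{R}^d$ and $\eta>0$, an $\eta$-net of $P$ is a set $N\subseteq P$ such that every point of $P$ is within distance $\eta$ of some point of $N$ and any two distinct points of $N$ are at distance at least $\eta$. For a family $\mathcal{F}$ of finite subsets of $\mathbb{R}^d$, call $s\ge 0$ an exponent of $\mathcal{F}$ if there is a constant $c$ such that $|N\cap \mathrm{ball}(x,r)|\le c\,(r/\eta)^s$ for all $P\in\mathcal{F}$, all $\eta>0$ and $r\ge 2\eta$, all $\eta$-nets $N$ of $P$ and all $x\in\mathbb{R}^d$, where $\mathrm{ball}(x,r)$ is the closed ball; the fractal dimension $\dim_{\mathsf f}(\mathcal{F})$ is the infimum of the exponents of $\mathcal{F}$. A $c$-spanner for $P$ is a graph $G$ with vertex set $P$ such that $\|x-y\|_2\le d_G(x,y)\le c\,\|x-y\|_2$ for all $x,y\in P$, where $d_G$ is the shortest-path distance when every edge has its Euclidean length. The pathwidth $\mathsf{pw}(G)$ is the least integer $k\ge1$ such that $G$ has a path decomposition with all bags of size at most $k+1$. Running times are on a real RAM. Theorem. There is an algorithm,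 depending only on $d$ and $\varepsilon$, which, given any set $P$ of $n$ points in $\mathbb{R}^d$ (as a list of $n$ distinct points), computes in time polynomial in $n$ a $(1+\varepsilon)$-spanner $G'$ for $P$ with $O(n)$ edges, such that the following holds. Let $\delta\in(0,d]$ and let $\mathcal{F}$ be a family of finite subsets of $\mathbb{R}^d$ with $\dim_{\mathsf f}(\mathcal{F})\le\delta$; if $\delta\ge 1$, assume moreover that $\delta$ itself is an exponent of $\mathcal{F}$ (which is automatic when $\dim_{\mathsf f}(\mathcal{F})<\delta$). Then for every $P\in\mathcal{F}$ with $n=|P|\ge2$, $$\mathsf{pw}(G')=\begin{cases}O(n^{1-1/\delta}\log n)&\text{if }\delta>1,\\ O(\log^2 n)&\text{if }\delta=1,\\ O(\log n)&\text{if }\delta<1.\end{cases}$$ The constant in the bound on the number of edges and the polynomial in the running time depend only on $d$ and $\varepsilon$; the constant in the bound on the pathwidth depends only on $d$, $\varepsilon$, $\delta$ and $\mathcal{F}$. -/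

import Mathlib

open scoped ENNReal

noncomputable section

/-! ## Nets and fractal dimension -/

/-- `S` is an `η`-net of `A`: a subset that is both an `η`-covering and an `η`-packing of `A`. -/
def IsNet {X : Type*} [PseudoMetricSpace X] (η : ℝ) (S A : Finset X) : Prop :=
  S ⊆ A ∧ (∀ x ∈ A, ∃ y ∈ S, dist x y ≤ η) ∧ (∀ x ∈ S, ∀ y ∈ S, x ≠ y → η ≤ dist x y)

/-- The exponents `s ≥ 0` for which every `η`-net of every member of the family `F` has
`O((r / η) ^ s)` points in every closed ball of radius `r ≥ 2 η`. The constant `c` is uniform over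
the family. -/
def fractalExponents {d : ℕ} (F : Set (Finset (EuclideanSpace ℝ (Fin d)))) : Set ℝ :=
  {s | 0 ≤ s ∧ ∃ c : ℝ, ∀ P ∈ F, ∀ η r : ℝ, 0 < η → 2 * η ≤ r →
    ∀ N : Finset (EuclideanSpace ℝ (Fin d)), IsNet η N P →
      ∀ x : EuclideanSpace ℝ (Fin d),
        (((N : Set (EuclideanSpace ℝ (Fin d))) ∩ Metric.closedBall x r).ncard : ℝ)
          ≤ c * (r / η) ^ s}

/-- The fractal dimension of a family of finite point sets in `ℝ^d`. -/
def fractalDim {d : ℕ} (F : Set (Finset (EuclideanSpace ℝ (Fin d)))) : ℝ :=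
  sInf (fractalExponents F)

/-! ## Geometric graphs, spanners, pathwidth -/

/-- The length of a walk when every edge `{u, v}` is as long as the distance from `pos u` to
`pos v`. -/
def walkLength {V X : Type*} [PseudoEMetricSpace X] (pos : V → X) {G : SimpleGraph V} :
    {u v : V} → G.Walk u v → ℝ≥0∞
  | _, _, .nil => 0
  | u, _, .cons (v := v) _ w => edist (pos u) (pos v) + walkLength pos w

/-- The shortest path distance in the graph `G` drawn at the positions `pos`
(it is `∞` between different connected components). -/
def graphDist {V X : Type*} [PseudoEMetricSpace X] (pos : V → X) (G : SimpleGraph V)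
    (u v : V) : ℝ≥0∞ :=
  ⨅ w : G.Walk u v, walkLength pos w

/-- `G` is a `c`-spanner of the points `pos v`. -/
def IsSpanner {V X : Type*} [PseudoEMetricSpace X] (c : ℝ) (pos : V → X)
    (G : SimpleGraph V) : Prop :=
  ∀ u v : V, edist (pos u) (pos v) ≤ graphDist pos G u v ∧
    graphDist pos G u v ≤ ENNReal.ofReal c * edist (pos u) (pos v)

/-- `bag` is a path decomposition of `G`. -/
def IsPathDecomposition {V : Type*} (G : SimpleGraph V) {l : ℕ} (bag : Fin l → Finset V) : Prop :=
  (∀ v, ∃ i, v ∈ bag i) ∧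
  (∀ u v, G.Adj u v → ∃ i, u ∈ bag i ∧ v ∈ bag i) ∧
  (∀ v, ∀ i j k, i < j → j < k → v ∈ bag i → v ∈ bag k → v ∈ bag j)

/-- The pathwidth of a finite graph: the least integer `k ≥ 1` such that there is a path
decomposition all of whose bags have at most `k + 1` vertices. -/
def pathwidth {V : Type*} (G : SimpleGraph V) : ℕ :=
  sInf {k | 1 ≤ k ∧ ∃ (l : ℕ) (bag : Fin l → Finset V),
    IsPathDecomposition G bag ∧ ∀ i, (bag i).card ≤ k + 1}

/-! ## The real RAM

The memory consists of arrays of natural numbers and arrays of real numbers. A program mentions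
finitely many of these arrays; entries are addressed by computed natural numbers. The operations on
naturals are addition, truncated subtraction and comparison (so that numbers of polynomially many
bits suffice for polynomially many steps); the operations on reals are the four arithmetic operations
and comparison, with rational constants. There is no rounding and no conversion from reals to
naturals. -/

namespace RealRAM

/-- `nat a i` is entry `i` of the natural number array `a`, similarly for `real a i`. -/
structure Memory where
  nat : ℕ → ℕ → ℕ
  real : ℕ → ℕ → ℝ

/-- Expressions for natural numbers. -/
inductive NExp where
  | lit (k : ℕ)
  | get (a : ℕ) (i : NExp)
  | add (e f : NExp)
  | sub (e f : NExp)

/-- Expressions for real numbers. -/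
inductive RExp where
  | lit (q : ℚ)
  | get (a : ℕ) (i : NExp)
  | add (e f : RExp)
  | sub (e f : RExp)
  | mul (e f : RExp)
  | div (e f : RExp)

/-- Tests. -/
inductive BExp where
  | natLE (e f : NExp)
  | realLE (e f : RExp)
  | not (b : BExp)
  | and (b c : BExp)

/-- Programs. -/
inductive Program where
  | skip
  | setNat (a : ℕ) (i e : NExp)
  | setReal (a : ℕ) (i : NExp) (e : RExp)
  | seq (p q : Program)
  | ite (b : BExp) (p q : Program)
  | loop (b : BExp) (p : Program)

def NExp.eval (m : Memory) : NExp → ℕ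
  | .lit k => k
  | .get a i => m.nat a (i.eval m)
  | .add e f => e.eval m + f.eval m
  | .sub e f => e.eval m - f.eval m

def RExp.eval (m : Memory) : RExp → ℝ
  | .lit q => (q : ℝ)
  | .get a i => m.real a (i.eval m)
  | .add e f => e.eval m + f.eval m
  | .sub e f => e.eval m - f.eval m
  | .mul e f => e.eval m * f.eval m
  | .div e f => e.eval m / f.eval m

def BExp.Holds (m : Memory) : BExp → Prop
  | .natLE e f => e.eval m ≤ f.eval m
  | .realLE e f => e.eval m ≤ f.eval m
  | .not b => ¬ b.Holds m
  | .and b c => b.Holds m ∧ c.Holds m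

def Memory.writeNat (m : Memory) (a i v : ℕ) : Memory :=
  { m with nat := Function.update m.nat a (Function.update (m.nat a) i v) }

def Memory.writeReal (m : Memory) (a i : ℕ) (v : ℝ) : Memory :=
  { m with real := Function.update m.real a (Function.update (m.real a) i v) }

/-- `p.Runs m m' t`: started in memory `m`, the program `p` halts after `t` steps in memory `m'`.
Every assignment and every evaluation of a test is one step; since the expressions in a fixed
program have bounded size, this is the number of elementary operations up to a factor that depends
only on the program. -/
inductive Program.Runs : Program → Memory → Memory → ℕ → Prop
  | skip (m : Memory) : Program.Runs .skip m m 1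
  | setNat (m : Memory) (a : ℕ) (i e : NExp) :
      Program.Runs (.setNat a i e) m (m.writeNat a (i.eval m) (e.eval m)) 1
  | setReal (m : Memory) (a : ℕ) (i : NExp) (e : RExp) :
      Program.Runs (.setReal a i e) m (m.writeReal a (i.eval m) (e.eval m)) 1
  | seq {p q : Program} {m m' m'' : Memory} {t t' : ℕ} :
      Program.Runs p m m' t → Program.Runs q m' m'' t' →
      Program.Runs (.seq p q) m m'' (t + t')
  | ite_true {b : BExp} {p q : Program} {m m' : Memory} {t : ℕ} :
      b.Holds m → Program.Runs p m m' t → Program.Runs (.ite b p q) m m' (t + 1)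
  | ite_false {b : BExp} {p q : Program} {m m' : Memory} {t : ℕ} :
      ¬ b.Holds m → Program.Runs q m m' t → Program.Runs (.ite b p q) m m' (t + 1)
  | loop_true {b : BExp} {p : Program} {m m' m'' : Memory} {t t' : ℕ} :
      b.Holds m → Program.Runs p m m' t → Program.Runs (.loop b p) m' m'' t' →
      Program.Runs (.loop b p) m m'' (t + t' + 1)
  | loop_false {b : BExp} {p : Program} {m : Memory} :
      ¬ b.Holds m → Program.Runs (.loop b p) m m 1

/-- The input `p 0, …, p (n - 1)`: the number `n` is in entry `0` of natural array `0`, and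
coordinate `j` of point `i` is in entry `i` of real array `j`; all other entries are `0`. -/
def inputMemory {d n : ℕ} (p : Fin n → EuclideanSpace ℝ (Fin d)) : Memory where
  nat a i := if a = 0 ∧ i = 0 then n else 0
  real j i := if h : j < d ∧ i < n then p ⟨i, h.2⟩ ⟨j, h.1⟩ else 0

/-- The graph on `0, …, n - 1` that is output as a list of edges: the length of the list is in
entry `0` of natural array `0`, and the ends of edge `k` are in entry `k` of natural
arrays `1` and `2`. -/
def outputGraph (n : ℕ) (m : Memory) : SimpleGraph (Fin n) :=
  SimpleGraph.fromRel fun i j => ∃ k < m.nat 0 0, m.nat 1 k = i ∧ m.nat 2 k = j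

/-- On input `p`, the program `A` outputs the graph `G` after at most `T` steps. -/
def Computes {d n : ℕ} (A : Program) (p : Fin n → EuclideanSpace ℝ (Fin d))
    (G : SimpleGraph (Fin n)) (T : ℕ) : Prop :=
  ∃ (m : Memory) (t : ℕ), A.Runs (inputMemory p) m t ∧ t ≤ T ∧ outputGraph n m = G

end RealRAM

end

/-! ## Packing in normed spaces -/

/-! A farthest-first traversal gives each point v a radius ρ v, its distance to the points visited
before it; the first point gets a radius exceeding all distances to it. For every r up to the
largest radius, the points of radius at least r form an r-net (`IsNetRadius`). The spanner
`netGraph` joins two points whose distance is at most K times the smaller of their radii, with K of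
order 1/ε; it does not depend on δ or on the family.

Stretch: to connect two points at distance D, climb from each through net points of doubling radius
up to radius about εD, at cost O(εD), and bridge the rest by a single edge
(`IsNetRadius.exists_climb`, `IsNetRadius.isSpanner_netGraph`). The number of edges is linear
because each edge is charged to its end of smaller radius, which receives O(1) of them by packing.

Pathwidth: take a smallest ball holding a constant fraction of a vertex set Q, of radius r, and cut
along a concentric sphere of random radius in [r, 2r] (`exists_dense_ball`,
`exists_radius_card_le`). A point enters the separator only if its edges can reach the sphere, which
has probability at most K min(1, ρ/r). If s is an exponent of the family, O(a^(-s)) points near the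
ball have ρ ≥ a r, so the j-th largest ratio is O(j^(-1/s)) and the separator has size O(∑
j^(-1/s)): this is n^(1-1/s) for s > 1, log n for s = 1 and bounded for s < 1. Recursing on both
sides costs one more factor log n (`hasPathDecomposition_netGraph`).

The machine has no square roots, so the program works with squared distances and squared radii
throughout. -/

open MeasureTheory Metric Module in
theorem card_le_of_separated_of_dist_le {V E : Type*} [NormedAddCommGroup E] [NormedSpace ℝ E]
    [FiniteDimensional ℝ E] (pos : V → E) (s : Finset V) (x : E) {r η : ℝ} (hη : 0 < η)
    (hr : 0 ≤ r) (hs : ∀ v ∈ s, dist (pos v) x ≤ r)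
    (h : ∀ u ∈ s, ∀ v ∈ s, u ≠ v → η ≤ dist (pos u) (pos v)) :
    (s.card : ℝ) ≤ (1 + 2 * r / η) ^ finrank ℝ E := by
  borelize E
  let μ : Measure E := Measure.addHaar
  have hδ : 0 < η / 2 := by positivity
  have hρ : 0 < η / 2 + r := by positivity
  have D : Set.Pairwise (s : Set V)
      (Function.onFun Disjoint fun v => ball (pos v) (η / 2)) := by
    rintro u hu v hv huv
    apply ball_disjoint_ball
    linarith [h u hu v hv huv]
  -- Volume comparison: disjoint balls of radius η/2 inside one ball of radius η/2 + r.
  have A_subset : (⋃ v ∈ s, ball (pos v) (η / 2)) ⊆ ball x (η / 2 + r) := by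
    refine Set.iUnion₂_subset fun v hv => ball_subset_ball' ?_
    linarith [hs v hv]
  have I : (s.card : ℝ≥0∞) * ENNReal.ofReal ((η / 2) ^ finrank ℝ E) * μ (ball 0 1) ≤
      ENNReal.ofReal ((η / 2 + r) ^ finrank ℝ E) * μ (ball 0 1) :=
    calc
      _ = μ (⋃ v ∈ s, ball (pos v) (η / 2)) := by
        rw [measure_biUnion_finset D fun c _ => measurableSet_ball]
        simp only [μ.addHaar_ball_of_pos _ hδ, Finset.sum_const, nsmul_eq_mul, mul_assoc]
      _ ≤ μ (ball x (η / 2 + r)) := measure_mono A_subset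
      _ = _ := by simp only [μ.addHaar_ball_of_pos _ hρ]
  have J := (ENNReal.mul_le_mul_iff_left (measure_ball_pos _ _ zero_lt_one).ne'
    measure_ball_lt_top.ne).1 I
  have K : (s.card : ℝ) * (η / 2) ^ finrank ℝ E ≤ (η / 2 + r) ^ finrank ℝ E := by
    have := ENNReal.toReal_le_of_le_ofReal (by positivity) J
    rwa [ENNReal.toReal_mul, ENNReal.toReal_natCast, ENNReal.toReal_ofReal (by positivity)] at this
  have e : 1 + 2 * r / η = (η / 2 + r) / (η / 2) := by field_simp
  rw [e, div_pow, le_div_iff₀ (by positivity)]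
  exact K

/-! ## Distances in geometric graphs -/

section graphDist

variable {V X : Type*} [PseudoEMetricSpace X] {pos : V → X} {G : SimpleGraph V}

theorem walkLength_append {u v w : V} (p : G.Walk u v) (q : G.Walk v w) :
    walkLength pos (p.append q) = walkLength pos p + walkLength pos q := by
  induction p with
  | nil => simp [walkLength]
  | cons h p ih => simp [walkLength, ih, add_assoc]

theorem edist_le_walkLength {u v : V} (p : G.Walk u v) :
    edist (pos u) (pos v) ≤ walkLength pos p := by
  induction p with
  | nil => simp [walkLength]
  | cons h p ih => exact (edist_triangle _ _ _).trans (by rw [walkLength]; gcongr)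

theorem edist_le_graphDist (u v : V) : edist (pos u) (pos v) ≤ graphDist pos G u v :=
  le_iInf edist_le_walkLength

theorem graphDist_self (u : V) : graphDist pos G u u = 0 :=
  le_antisymm ((iInf_le _ SimpleGraph.Walk.nil).trans (by simp [walkLength])) zero_le

theorem graphDist_le_edist {u v : V} (h : G.Adj u v) :
    graphDist pos G u v ≤ edist (pos u) (pos v) :=
  (iInf_le _ (SimpleGraph.Walk.cons h SimpleGraph.Walk.nil)).trans (by simp [walkLength])

theorem graphDist_triangle (u v w : V) :
    graphDist pos G u w ≤ graphDist pos G u v + graphDist pos G v w := by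
  unfold graphDist
  rw [ENNReal.iInf_add]
  refine le_iInf fun p => ?_
  rw [ENNReal.add_iInf]
  refine le_iInf fun q => ?_
  rw [← walkLength_append]
  exact iInf_le _ _

theorem walkLength_reverse {u v : V} (p : G.Walk u v) :
    walkLength pos p.reverse = walkLength pos p := by
  induction p with
  | nil => simp [walkLength]
  | cons h p ih => simp [walkLength, walkLength_append, ih, add_comm, edist_comm]

theorem graphDist_comm (u v : V) : graphDist pos G u v = graphDist pos G v u := by
  refine le_antisymm (le_iInf fun p => ?_) (le_iInf fun p => ?_) <;>
  · rw [← walkLength_reverse]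
    exact iInf_le _ _

end graphDist

/-! ## Hierarchical nets -/

/-- The radius function of a hierarchy of nets: the points of radius at least `r` form an
`r`-net. -/
structure IsNetRadius {V X : Type*} [PseudoMetricSpace X] (pos : V → X) (ρ : V → ℝ) : Prop where
  pos_radius : ∀ v, 0 < ρ v
  separated : ∀ u v, u ≠ v → min (ρ u) (ρ v) ≤ dist (pos u) (pos v)
  cover : ∀ r w, 0 < r → r ≤ ρ w → ∀ v, ∃ y, r ≤ ρ y ∧ dist (pos v) (pos y) ≤ r
  wide : ∀ u v, ∃ w, dist (pos u) (pos v) ≤ 2 * ρ w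

/-- Two points are joined when they are close relative to both of their radii. -/
def netGraph {V X : Type*} [PseudoMetricSpace X] (K : ℝ) (pos : V → X) (ρ : V → ℝ) :
    SimpleGraph V where
  Adj u v := u ≠ v ∧ dist (pos u) (pos v) ≤ K * ρ u ∧ dist (pos u) (pos v) ≤ K * ρ v
  symm := ⟨fun u v h => ⟨h.1.symm, by rw [dist_comm]; exact h.2.2, by rw [dist_comm]; exact h.2.1⟩⟩
  loopless := ⟨fun _ h => h.1 rfl⟩

section spanner

variable {V X : Type*} [PseudoMetricSpace X] {pos : V → X} {ρ : V → ℝ} {K : ℝ}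

/-- A step from u costs at most 2ρ(u) and either reaches radius R or at least doubles the radius, so
the costs form a geometric series. The budget 4R - 2ρ(u) is a potential that absorbs them: 2ρ(u) +
(4R - 2ρ(y)) ≤ 4R - 2ρ(u) once ρ(y) ≥ 2ρ(u). -/
theorem IsNetRadius.exists_climb [Finite V] (h : IsNetRadius pos ρ) (hK : 2 ≤ K) {R : ℝ} {w : V}
    (hR : R ≤ ρ w) (u : V) :
    R ≤ ρ u ∨ ∃ y, R ≤ ρ y ∧
      graphDist pos (netGraph K pos ρ) u y ≤ ENNReal.ofReal (4 * R - 2 * ρ u) ∧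
      dist (pos u) (pos y) ≤ 4 * R - 2 * ρ u := by
  have : WellFounded fun a b : V => ρ b < ρ a :=
    Finite.wellFounded_of_trans_of_irrefl (r := fun a b : V => ρ b < ρ a)
  induction u using this.induction with
  | _ u ih =>
  by_cases hu : R ≤ ρ u
  · exact Or.inl hu
  right
  push Not at hu
  have hu0 := h.pos_radius u
  -- The level is capped at R so that `w` witnesses that it is inhabited.
  obtain ⟨y, hy, hd⟩ := h.cover (min (2 * ρ u) R) w
    (lt_min (by linarith) (by linarith)) ((min_le_right _ _).trans hR) u
  have huy : ρ u < ρ y := lt_of_lt_of_le (lt_min (by linarith) hu) hy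
  have hd2 : dist (pos u) (pos y) ≤ 2 * ρ u := hd.trans (min_le_left _ _)
  have hadj : (netGraph K pos ρ).Adj u y := by
    refine ⟨fun e => by simp [e] at huy, hd2.trans (by nlinarith), hd2.trans ?_⟩
    nlinarith
  have h1 : graphDist pos (netGraph K pos ρ) u y ≤ ENNReal.ofReal (2 * ρ u) := by
    refine (graphDist_le_edist hadj).trans ?_
    rw [edist_dist]
    exact ENNReal.ofReal_le_ofReal hd2
  by_cases hyR : R ≤ ρ y
  · exact ⟨y, hyR, h1.trans (ENNReal.ofReal_le_ofReal (by linarith)), by linarith⟩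
  rcases ih y huy with h' | ⟨z, hz, hz1, hz2⟩
  · exact absurd h' hyR
  have h2 : 2 * ρ u ≤ ρ y := by
    rcases min_le_iff.1 hy with h' | h'
    · exact h'
    · exact absurd h' hyR
  push Not at hyR
  refine ⟨z, hz, ?_, ?_⟩
  · refine (graphDist_triangle _ y _).trans ((add_le_add h1 hz1).trans ?_)
    rw [← ENNReal.ofReal_add (by linarith) (by linarith)]
    exact ENNReal.ofReal_le_ofReal (by linarith)
  · exact (dist_triangle _ (pos y) _).trans (by linarith)

theorem IsNetRadius.isSpanner_netGraph [Finite V] (h : IsNetRadius pos ρ) {ε : ℝ} {N : ℕ}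
    (hN : 0 < N) (hε : 1 / (N : ℝ) ≤ ε) :
    IsSpanner (1 + ε) pos (netGraph (16 * N + 8) pos ρ) := by
  intro u v
  refine ⟨edist_le_graphDist u v, ?_⟩
  have hN1 : (1 : ℝ) ≤ N := by exact_mod_cast hN
  have hε0 : 0 < ε := lt_of_lt_of_le (by positivity) hε
  obtain ⟨w, hw⟩ := h.wide u v
  set D := dist (pos u) (pos v) with hD
  have hD0 : 0 ≤ D := dist_nonneg
  -- The two climbs cost 4R each and lengthen the middle edge by at most 8R. So that edge has length
  -- at most D + 8R = (16N + 8)R, just what `netGraph` admits at radius R, and the total is D + 16R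
  -- = (1 + 1/N)D.
  set R := D / (16 * N) with hR
  have hR0 : 0 ≤ R := by positivity
  have hDR : D = 16 * N * R := by rw [hR]; field_simp
  have hRw : R ≤ ρ w := by nlinarith
  have climb : ∀ u, ∃ y, R ≤ ρ y ∧
      graphDist pos (netGraph (16 * N + 8) pos ρ) u y ≤ ENNReal.ofReal (4 * R) ∧
      dist (pos u) (pos y) ≤ 4 * R := by
    intro u
    rcases h.exists_climb (K := 16 * N + 8) (by linarith) hRw u with h' | ⟨y, h1, h2, h3⟩
    · exact ⟨u, h', by simp [graphDist_self], by simp [hR0]⟩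
    · have := h.pos_radius u
      exact ⟨y, h1, h2.trans (ENNReal.ofReal_le_ofReal (by linarith)), by linarith⟩
  obtain ⟨a, ha1, ha2, ha3⟩ := climb u
  obtain ⟨b, hb1, hb2, hb3⟩ := climb v
  have hab : dist (pos a) (pos b) ≤ D + 8 * R := by
    have h1 := dist_triangle4 (pos a) (pos u) (pos v) (pos b)
    rw [dist_comm (pos a) (pos u)] at h1
    linarith
  have hab' : graphDist pos (netGraph (16 * N + 8) pos ρ) a b ≤ ENNReal.ofReal (D + 8 * R) := by
    by_cases e : a = b
    · simp [e, graphDist_self]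
    · have hadj : (netGraph (16 * N + 8) pos ρ).Adj a b := by
        refine ⟨e, hab.trans ?_, hab.trans ?_⟩ <;> nlinarith
      refine (graphDist_le_edist hadj).trans ?_
      rw [edist_dist]
      exact ENNReal.ofReal_le_ofReal hab
  rw [graphDist_comm] at hb2
  calc graphDist pos (netGraph (16 * N + 8) pos ρ) u v
      ≤ ENNReal.ofReal (4 * R) + (ENNReal.ofReal (D + 8 * R) + ENNReal.ofReal (4 * R)) :=
        (graphDist_triangle _ a _).trans
          (add_le_add ha2 ((graphDist_triangle _ b _).trans (add_le_add hab' hb2)))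
    _ = ENNReal.ofReal (D + 16 * R) := by
        rw [← ENNReal.ofReal_add (by positivity) (by positivity),
          ← ENNReal.ofReal_add (by positivity) (by positivity)]
        congr 1
        ring
    _ ≤ ENNReal.ofReal ((1 + ε) * D) := by
        refine ENNReal.ofReal_le_ofReal ?_
        have : 16 * R = 1 / N * D := by rw [hR]; field_simp
        rw [this]
        nlinarith
    _ = _ := by rw [ENNReal.ofReal_mul (by positivity), edist_dist]

end spanner

-- Each edge is charged to its end u of smaller radius; the other ends are ρ(u)-separated and lie
-- within Kρ(u) of u, so packing bounds their number.
open Classical in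
theorem IsNetRadius.ncard_edgeSet_netGraph_le {V E : Type*} [Fintype V] [NormedAddCommGroup E]
    [NormedSpace ℝ E] [FiniteDimensional ℝ E] {pos : V → E} {ρ : V → ℝ} {K : ℝ} (hK : 0 ≤ K)
    (h : IsNetRadius pos ρ) :
    ((netGraph K pos ρ).edgeSet.ncard : ℝ)
      ≤ (1 + 2 * K) ^ Module.finrank ℝ E * Fintype.card V := by
  let nb : V → Finset V := fun u => {v | ρ u ≤ ρ v ∧ dist (pos v) (pos u) ≤ K * ρ u}
  have hnb : ∀ u, ((nb u).card : ℝ) ≤ (1 + 2 * K) ^ Module.finrank ℝ E := by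
    intro u
    have hu := h.pos_radius u
    have := card_le_of_separated_of_dist_le pos (nb u) (pos u) hu
      (mul_nonneg hK hu.le) (fun v hv => (Finset.mem_filter.1 hv).2.2)
      (fun a ha b hb hab => (le_min (Finset.mem_filter.1 ha).2.1
        (Finset.mem_filter.1 hb).2.1).trans (h.separated a b hab))
    have e : 2 * (K * ρ u) / ρ u = 2 * K := by field_simp
    rwa [e] at this
  have hsub : (netGraph K pos ρ).edgeSet ⊆
      ((Finset.univ.biUnion fun u => (nb u).image fun v => s(u, v) : Finset (Sym2 V)) :
        Set (Sym2 V)) := by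
    intro e
    induction e using Sym2.ind with
    | _ u v =>
    intro he
    obtain ⟨-, h1, h2⟩ : u ≠ v ∧ _ := he
    simp only [Finset.coe_biUnion, Finset.mem_coe, Finset.mem_univ, Set.iUnion_true, Set.mem_iUnion,
      Finset.mem_image]
    rcases le_total (ρ u) (ρ v) with h3 | h3
    · exact ⟨u, v, by simp [nb, h3, dist_comm (pos v), h1], rfl⟩
    · exact ⟨v, u, by simp [nb, h3, h2], Sym2.eq_swap⟩
  calc ((netGraph K pos ρ).edgeSet.ncard : ℝ)
      ≤ ((Finset.univ.biUnion fun u => (nb u).image fun v => s(u, v)).card : ℝ) := by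
        rw [← Set.ncard_coe_finset]
        exact_mod_cast Set.ncard_le_ncard hsub (Finset.finite_toSet _)
    _ ≤ ∑ u : V, ((nb u).card : ℝ) := by
        refine le_trans (Nat.cast_le.2 Finset.card_biUnion_le) ?_
        push_cast
        exact Finset.sum_le_sum fun u _ => Nat.cast_le.2 Finset.card_image_le
    _ ≤ ∑ u : V, (1 + 2 * K) ^ Module.finrank ℝ E := Finset.sum_le_sum fun u _ => hnb u
    _ = _ := by simp [mul_comm]

/-! ## Path decompositions of vertex sets -/

/-- The subgraph of `G` induced by `Q` has a path decomposition with bags of at most `w`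
vertices. -/
def HasPathDecomposition {V : Type*} (G : SimpleGraph V) (Q : Finset V) (w : ℝ) : Prop :=
  ∃ (l : ℕ) (bag : ℕ → Finset V), 0 < l ∧ (∀ v ∈ Q, ∃ i < l, v ∈ bag i) ∧
    (∀ u ∈ Q, ∀ v ∈ Q, G.Adj u v → ∃ i < l, u ∈ bag i ∧ v ∈ bag i) ∧
    (∀ v, ∀ i j k, i < j → j < k → k < l → v ∈ bag i → v ∈ bag k → v ∈ bag j) ∧
    ∀ i < l, bag i ⊆ Q ∧ ((bag i).card : ℝ) ≤ w

section pathDecomposition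

variable {V : Type*} {G : SimpleGraph V}

theorem HasPathDecomposition.mono {Q : Finset V} {w w' : ℝ} (h : HasPathDecomposition G Q w)
    (hw : w ≤ w') : HasPathDecomposition G Q w' := by
  obtain ⟨l, bag, h0, h1, h2, h3, h4⟩ := h
  exact ⟨l, bag, h0, h1, h2, h3, fun i hi => ⟨(h4 i hi).1, (h4 i hi).2.trans hw⟩⟩

theorem hasPathDecomposition_card (Q : Finset V) : HasPathDecomposition G Q Q.card :=
  ⟨1, fun _ => Q, one_pos, fun _ hv => ⟨0, one_pos, hv⟩, fun _ hu _ hv _ => ⟨0, one_pos, hu, hv⟩,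
    fun _ _ _ _ _ _ _ h _ => h, fun _ _ => ⟨subset_rfl, le_rfl⟩⟩

/-- Concatenate the two decompositions and add the separator S to every bag. A vertex outside S
cannot occur in both halves, because A and B are disjoint. -/
theorem HasPathDecomposition.join [DecidableEq V] {S A B : Finset V} {w : ℝ}
    (hAB : Disjoint A B) (hadj : ∀ u ∈ A, ∀ v ∈ B, ¬ G.Adj u v)
    (hA : HasPathDecomposition G A w) (hB : HasPathDecomposition G B w) :
    HasPathDecomposition G (S ∪ A ∪ B) (S.card + w) := by
  obtain ⟨l, bag, h0, h1, h2, h3, h4⟩ := hA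
  obtain ⟨l', bag', h0', h1', h2', h3', h4'⟩ := hB
  have hl : ∀ i < l, S ∪ bag i = S ∪ (if i < l then bag i else bag' (i - l)) := by
    intro i hi
    rw [if_pos hi]
  have hr : ∀ i, S ∪ bag' i = S ∪ (if l + i < l then bag (l + i) else bag' (l + i - l)) := by
    intro i
    rw [if_neg (by omega), Nat.add_sub_cancel_left]
  have memA : ∀ v ∈ A, ∃ i < l + l', v ∈ S ∪ (if i < l then bag i else bag' (i - l)) := by
    intro v hv
    obtain ⟨i, hi, hv⟩ := h1 v hv
    exact ⟨i, by omega, (hl i hi).subset (Finset.mem_union_right _ hv)⟩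
  have memB : ∀ v ∈ B, ∃ i < l + l', v ∈ S ∪ (if i < l then bag i else bag' (i - l)) := by
    intro v hv
    obtain ⟨i, hi, hv⟩ := h1' v hv
    exact ⟨l + i, by omega, (hr i).subset (Finset.mem_union_right _ hv)⟩
  have mem : ∀ v ∈ S ∪ A ∪ B,
      ∃ i < l + l', v ∈ S ∪ (if i < l then bag i else bag' (i - l)) := by
    intro v hv
    rcases Finset.mem_union.1 hv with hv | hv
    · rcases Finset.mem_union.1 hv with hv | hv
      -- Bag 0 exists even if A and B are empty, since decompositions are required to have positive
      -- length.
      · exact ⟨0, by omega, Finset.mem_union_left _ hv⟩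
      · exact memA v hv
    · exact memB v hv
  refine ⟨l + l', fun i => S ∪ (if i < l then bag i else bag' (i - l)), by omega, mem, ?_, ?_, ?_⟩
  · intro u hu v hv huv
    by_cases huS : u ∈ S
    · obtain ⟨i, hi, hvi⟩ := mem v hv
      exact ⟨i, hi, Finset.mem_union_left _ huS, hvi⟩
    by_cases hvS : v ∈ S
    · obtain ⟨i, hi, hui⟩ := mem u hu
      exact ⟨i, hi, hui, Finset.mem_union_left _ hvS⟩
    simp only [Finset.mem_union, huS, hvS, false_or] at hu hv
    rcases hu with hu | hu <;> rcases hv with hv | hv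
    · obtain ⟨i, hi, hui, hvi⟩ := h2 u hu v hv huv
      exact ⟨i, by omega, (hl i hi).subset (Finset.mem_union_right _ hui),
        (hl i hi).subset (Finset.mem_union_right _ hvi)⟩
    · exact absurd huv (hadj u hu v hv)
    · exact absurd huv.symm (hadj v hv u hu)
    · obtain ⟨i, hi, hui, hvi⟩ := h2' u hu v hv huv
      exact ⟨l + i, by omega, (hr i).subset (Finset.mem_union_right _ hui),
        (hr i).subset (Finset.mem_union_right _ hvi)⟩
  · intro v i j k hij hjk hk hvi hvk
    by_cases hvS : v ∈ S
    · exact Finset.mem_union_left _ hvS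
    simp only [Finset.mem_union, hvS, false_or] at hvi hvk ⊢
    by_cases hkl : k < l
    · rw [if_pos (by omega)] at hvi hvk ⊢
      exact h3 v i j k hij hjk hkl hvi hvk
    rw [if_neg hkl] at hvk
    by_cases hil : i < l
    · rw [if_pos hil] at hvi
      exact absurd ((h4' _ (by omega)).1 hvk)
        (Finset.disjoint_left.1 hAB ((h4 i hil).1 hvi))
    rw [if_neg hil] at hvi
    rw [if_neg (by omega)]
    exact h3' v (i - l) (j - l) (k - l) (by omega) (by omega) (by omega) hvi hvk
  · intro i hi
    by_cases hil : i < l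
    · simp only [if_pos hil]
      obtain ⟨h5, h6⟩ := h4 i hil
      refine ⟨(Finset.union_subset_union_right h5).trans Finset.subset_union_left, ?_⟩
      calc ((S ∪ bag i).card : ℝ) ≤ S.card + (bag i).card := by
            exact_mod_cast Finset.card_union_le _ _
        _ ≤ _ := by linarith
    · simp only [if_neg hil]
      obtain ⟨h5, h6⟩ := h4' (i - l) (by omega)
      refine ⟨?_, ?_⟩
      · rw [Finset.union_right_comm]
        exact (Finset.union_subset_union_right h5).trans Finset.subset_union_left
      calc ((S ∪ bag' (i - l)).card : ℝ) ≤ S.card + (bag' (i - l)).card := by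
            exact_mod_cast Finset.card_union_le _ _
        _ ≤ _ := by linarith

theorem HasPathDecomposition.pathwidth_le [Fintype V] {w : ℝ}
    (h : HasPathDecomposition G Finset.univ w) : (pathwidth G : ℝ) ≤ max 1 w := by
  obtain ⟨l, bag, -, h1, h2, h3, h4⟩ := h
  have hk : pathwidth G ≤ max 1 ⌊w⌋₊ := by
    refine Nat.sInf_le ⟨le_max_left _ _, l, fun i => bag i, ⟨?_, ?_, ?_⟩, ?_⟩
    · intro v
      obtain ⟨i, hi, hv⟩ := h1 v (Finset.mem_univ _)
      exact ⟨⟨i, hi⟩, hv⟩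
    · intro u v huv
      obtain ⟨i, hi, hv⟩ := h2 u (Finset.mem_univ _) v (Finset.mem_univ _) huv
      exact ⟨⟨i, hi⟩, hv⟩
    · intro v i j k hij hjk hi hk
      exact h3 v i j k hij hjk k.2 hi hk
    · intro i
      have := Nat.le_floor (h4 i i.2).2
      exact (this.trans (le_max_right 1 _)).trans (Nat.le_succ _)
  rcases le_total 1 ⌊w⌋₊ with h' | h'
  · rw [max_eq_right h'] at hk
    refine le_max_of_le_right (le_trans (Nat.cast_le.2 hk) (Nat.floor_le ?_))
    by_contra hw
    rw [Nat.floor_of_nonpos (le_of_not_ge hw)] at h'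
    omega
  · rw [max_eq_left h'] at hk
    exact le_max_of_le_left (by exact_mod_cast hk)

end pathDecomposition

/-! ## Balanced separators by balls -/

theorem exists_separated_cover {V X : Type*} [PseudoMetricSpace X] (pos : V → X) {η : ℝ}
    (hη : 0 < η) (Q : Finset V) :
    ∃ T ⊆ Q, (∀ u ∈ T, ∀ v ∈ T, u ≠ v → η ≤ dist (pos u) (pos v)) ∧
      ∀ v ∈ Q, ∃ y ∈ T, dist (pos v) (pos y) < η := by
  classical
  induction Q using Finset.induction_on with
  | empty => exact ⟨∅, by simp⟩
  | insert a Q ha ih =>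
    obtain ⟨T, hTQ, h1, h2⟩ := ih
    by_cases h : ∃ y ∈ T, dist (pos a) (pos y) < η
    · refine ⟨T, hTQ.trans (Finset.subset_insert _ _), h1, fun v hv => ?_⟩
      rcases Finset.mem_insert.1 hv with rfl | hv
      · exact h
      · exact h2 v hv
    · push Not at h
      refine ⟨insert a T, Finset.insert_subset_insert _ hTQ, ?_, ?_⟩
      · intro u hu v hv huv
        rcases Finset.mem_insert.1 hu with hu | hu <;> rcases Finset.mem_insert.1 hv with hv | hv
        · exact absurd (hu.trans hv.symm) huv
        · rw [hu]
          exact h v hv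
        · rw [hv, dist_comm]
          exact h u hu
        · exact h1 u hu v hv huv
      · intro v hv
        rcases Finset.mem_insert.1 hv with rfl | hv
        · exact ⟨v, Finset.mem_insert_self _ _, by simpa using hη⟩
        · obtain ⟨y, hy, hd⟩ := h2 v hv
          exact ⟨y, Finset.mem_insert_of_mem hy, hd⟩

-- Choose the smallest ball centred at a point of Q that holds t points. The ball of twice the
-- radius is covered by at most 9^dim balls of half the radius centred in Q, and by minimality none
-- of these holds more than t points.
open Classical in
theorem exists_dense_ball {V E : Type*} [NormedAddCommGroup E] [NormedSpace ℝ E]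
    [FiniteDimensional ℝ E] {pos : V → E} (hpos : Function.Injective pos) (Q : Finset V) {t : ℕ}
    (ht : 2 ≤ t) (htQ : t ≤ Q.card) :
    ∃ (x : E) (r : ℝ), 0 < r ∧ t ≤ (Q.filter fun u => dist (pos u) x ≤ r).card ∧
      ((Q.filter fun u => dist (pos u) x ≤ 2 * r).card : ℝ) ≤ 9 ^ Module.finrank ℝ E * t := by
  -- A ball is encoded by its centre and a point of Q on its boundary, which makes the minimum over
  -- radii a finite one.
  let S : Finset (V × V) := (Q ×ˢ Q).filter fun z =>
    t ≤ (Q.filter fun u => dist (pos u) (pos z.1) ≤ dist (pos z.2) (pos z.1)).card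
  have key : ∀ x ∈ Q, ∀ r, t ≤ (Q.filter fun u => dist (pos u) (pos x) ≤ r).card →
      ∃ y, (x, y) ∈ S ∧ dist (pos y) (pos x) ≤ r := by
    intro x hx r hr
    obtain ⟨y, hy, hmax⟩ := Finset.exists_max_image
      (Q.filter fun u => dist (pos u) (pos x) ≤ r) (fun u => dist (pos u) (pos x))
      (Finset.card_pos.1 (by omega))
    refine ⟨y, Finset.mem_filter.2 ⟨Finset.mem_product.2 ⟨hx, (Finset.mem_filter.1 hy).1⟩, ?_⟩,
      (Finset.mem_filter.1 hy).2⟩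
    refine hr.trans (Finset.card_le_card fun u hu => ?_)
    exact Finset.mem_filter.2 ⟨(Finset.mem_filter.1 hu).1, hmax u hu⟩
  have hS : S.Nonempty := by
    obtain ⟨x, hx⟩ : Q.Nonempty := Finset.card_pos.1 (by omega)
    obtain ⟨y, -, hy⟩ := Finset.exists_max_image Q (fun u => dist (pos u) (pos x)) ⟨x, hx⟩
    obtain ⟨z, hz, -⟩ := key x hx (dist (pos y) (pos x)) (by
      rwa [Finset.filter_true_of_mem hy])
    exact ⟨_, hz⟩
  obtain ⟨⟨x, y⟩, hxy, hmin⟩ := Finset.exists_min_image S (fun z => dist (pos z.2) (pos z.1)) hS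
  have hcard := (Finset.mem_filter.1 hxy).2
  simp only at hcard hmin
  -- A ball of radius 0 holds a single point by injectivity, whereas t ≥ 2.
  have hr : 0 < dist (pos y) (pos x) := by
    by_contra h0
    have h0 : dist (pos y) (pos x) = 0 := le_antisymm (not_lt.1 h0) dist_nonneg
    have : (Q.filter fun u => dist (pos u) (pos x) ≤ dist (pos y) (pos x)).card ≤ 1 := by
      refine Finset.card_le_one.2 fun a ha b hb => ?_
      have h1 := (Finset.mem_filter.1 ha).2
      have h2 := (Finset.mem_filter.1 hb).2
      rw [h0] at h1 h2
      exact hpos ((dist_le_zero.1 h1).trans (dist_le_zero.1 h2).symm)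
    omega
  set r := dist (pos y) (pos x) with hrdef
  refine ⟨pos x, r, hr, hcard, ?_⟩
  have small : ∀ z ∈ Q, (Q.filter fun u => dist (pos u) (pos z) ≤ r / 2).card ≤ t := by
    intro z hz
    by_contra h
    obtain ⟨w, hw, hwr⟩ := key z hz (r / 2) (by omega)
    have := hmin _ hw
    simp only at this
    linarith
  obtain ⟨T, hTQ, hT1, hT2⟩ := exists_separated_cover pos (half_pos hr)
    (Q.filter fun u => dist (pos u) (pos x) ≤ 2 * r)
  have hT : (T.card : ℝ) ≤ 9 ^ Module.finrank ℝ E := by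
    have := card_le_of_separated_of_dist_le pos T (pos x) (half_pos hr) (r := 2 * r)
      (by positivity) (fun v hv => (Finset.mem_filter.1 (hTQ hv)).2) hT1
    have e : 1 + 2 * (2 * r) / (r / 2) = 9 := by field_simp; norm_num
    rwa [e] at this
  have hsub : (Q.filter fun u => dist (pos u) (pos x) ≤ 2 * r) ⊆
      T.biUnion fun z => Q.filter fun u => dist (pos u) (pos z) ≤ r / 2 := by
    intro v hv
    obtain ⟨z, hz, hd⟩ := hT2 v hv
    exact Finset.mem_biUnion.2 ⟨z, hz, Finset.mem_filter.2 ⟨(Finset.mem_filter.1 hv).1, hd.le⟩⟩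
  have h1 : (Q.filter fun u => dist (pos u) (pos x) ≤ 2 * r).card ≤ T.card * t :=
    (Finset.card_le_card hsub).trans
      (Finset.card_biUnion_le_card_mul _ _ _ fun z hz =>
        small z (Finset.mem_filter.1 (hTQ hz)).1)
  calc ((Q.filter fun u => dist (pos u) (pos x) ≤ 2 * r).card : ℝ) ≤ T.card * t := by
        exact_mod_cast h1
    _ ≤ _ := by gcongr

-- Average over R in [r, 2r]: u is counted for a set of R of length at most min(r, b u), and for
-- none if a u > 2r. Some R does no worse than the average.
open MeasureTheory in
open Classical in
theorem exists_radius_card_le {V : Type*} (Q : Finset V) (a b : V → ℝ) {r : ℝ} (hr : 0 < r)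
    (hb : ∀ u ∈ Q, 0 ≤ b u) :
    ∃ R, r ≤ R ∧ R ≤ 2 * r ∧ ((Q.filter fun u => a u ≤ R ∧ R ≤ a u + b u).card : ℝ)
      ≤ ∑ u ∈ Q with a u ≤ 2 * r, min 1 (b u / r) := by
  let f : ℝ → ℝ := fun R => ∑ u ∈ Q, (Set.Icc (a u) (a u + b u)).indicator (fun _ => (1 : ℝ)) R
  have hvol : volume (Set.Icc r (2 * r)) = ENNReal.ofReal r := by
    rw [Real.volume_Icc]
    congr 1
    ring
  have hint : ∀ u ∈ Q, IntegrableOn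
      ((Set.Icc (a u) (a u + b u)).indicator (fun _ => (1 : ℝ))) (Set.Icc r (2 * r)) := by
    intro u _
    refine Integrable.indicator ?_ measurableSet_Icc
    exact integrableOn_const (by rw [hvol]; exact ENNReal.ofReal_ne_top)
  obtain ⟨R, hR, hfR⟩ := exists_le_setAverage (μ := volume) (s := Set.Icc r (2 * r)) (f := f)
    (by rw [hvol]; simpa using hr) (by rw [hvol]; exact ENNReal.ofReal_ne_top)
    (integrable_finsetSum _ hint)
  refine ⟨R, hR.1, hR.2, ?_⟩
  have hcard : ((Q.filter fun u => a u ≤ R ∧ R ≤ a u + b u).card : ℝ) = f R := by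
    simp only [f, Set.indicator_apply, Set.mem_Icc, Finset.sum_boole]
  rw [hcard]
  refine hfR.trans ?_
  rw [setAverage_eq, Measure.real, hvol, ENNReal.toReal_ofReal hr.le,
    integral_finsetSum _ hint, smul_eq_mul, Finset.mul_sum, Finset.sum_filter]
  refine Finset.sum_le_sum fun u hu => ?_
  have hb := hb u hu
  rw [integral_indicator measurableSet_Icc, setIntegral_const, Measure.real,
    Measure.restrict_apply measurableSet_Icc, Set.Icc_inter_Icc, Real.volume_Icc, smul_eq_mul,
    mul_one]
  split_ifs with h
  · rw [inv_mul_le_iff₀ hr, ENNReal.toReal_ofReal']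
    have e : r * min 1 (b u / r) = min r (b u) := by
      rw [mul_min_of_nonneg _ _ hr.le, mul_one, mul_div_cancel₀ _ hr.ne']
    rw [e]
    refine max_le (le_min ?_ ?_) (le_min hr.le hb)
    · have h1 := min_le_right (a u + b u) (2 * r)
      have h2 := le_max_right (a u) r
      linarith
    · have h1 := min_le_left (a u + b u) (2 * r)
      have h2 := le_max_left (a u) r
      linarith
  · push Not at h
    rw [ENNReal.ofReal_of_nonpos, ENNReal.toReal_zero, mul_zero]
    have h1 := min_le_right (a u + b u) (2 * r)
    have h2 := le_max_left (a u) r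
    linarith

/-- The values of a positive function with polynomially decaying distribution are bounded by rank. -/
theorem sum_le_sum_rpow_of_card_mul_rpow_le {V : Type*} (Q : Finset V) (a : V → ℝ) {s c : ℝ}
    (hs : 0 < s) (ha : ∀ u ∈ Q, 0 < a u)
    (h : ∀ u ∈ Q, ((Q.filter fun v => a u ≤ a v).card : ℝ) * a u ^ s ≤ c) :
    ∑ u ∈ Q, a u ≤ ∑ j ∈ Finset.range Q.card, (c / (j + 1)) ^ (1 / s) := by
  classical
  -- The inserted point has the smallest value, so its upper level set is everything and its value
  -- is bounded by the last term of the sum.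
  induction Q using Finset.induction_on_min_value a with
  | empty => simp
  | insert x Q hx hmin ih =>
    rw [Finset.sum_insert hx, Finset.card_insert_of_notMem hx, Finset.sum_range_succ, add_comm]
    have hax := ha x (Finset.mem_insert_self _ _)
    refine add_le_add (ih (fun u hu => ha u (Finset.mem_insert_of_mem hu)) fun u hu => ?_) ?_
    · refine le_trans ?_ (h u (Finset.mem_insert_of_mem hu))
      have := (ha u (Finset.mem_insert_of_mem hu)).le
      gcongr
      exact Finset.subset_insert _ _
    · have h1 := h x (Finset.mem_insert_self _ _)
      rw [Finset.filter_true_of_mem (by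
        intro v hv
        rcases Finset.mem_insert.1 hv with rfl | hv
        · exact le_rfl
        · exact hmin v hv), Finset.card_insert_of_notMem hx] at h1
      push_cast at h1
      have h2 : a x ^ s ≤ c / (Q.card + 1) := by
        rw [le_div_iff₀ (by positivity)]
        linarith
      calc a x = (a x ^ s) ^ (1 / s) := by
            rw [← Real.rpow_mul hax.le, mul_one_div_cancel hs.ne', Real.rpow_one]
        _ ≤ _ := by gcongr

/-! ## Pathwidth of net graphs -/

open Classical in
/-- In every ball, the nets of the hierarchy have at most `c * (r / η) ^ s` points. -/
def HasNetGrowth {V X : Type*} [Fintype V] [PseudoMetricSpace X] (pos : V → X) (ρ : V → ℝ)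
    (c s : ℝ) : Prop :=
  ∀ (η r : ℝ) (w : V) (x : X), 0 < η → 2 * η ≤ r → η ≤ ρ w →
    ((Finset.univ.filter fun v => η ≤ ρ v ∧ dist (pos v) x ≤ r).card : ℝ) ≤ c * (r / η) ^ s

section netGraph

variable {V E : Type*} [Fintype V] {K c s : ℝ} {ρ : V → ℝ}

-- The points with min(1, ρ/r) ≥ a have radius at least a r, so net growth at scale η = a r in the
-- ball of radius 2r bounds their number by c(2/a)^s. Rank then bounds the sum.
open Classical in
theorem HasNetGrowth.sum_min_le [PseudoMetricSpace E] {pos : V → E} (hρ : ∀ v, 0 < ρ v)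
    (hg : HasNetGrowth pos ρ c s) (hc : 0 ≤ c) (hs : 0 < s) (Q : Finset V) (x : E) {r : ℝ}
    (hr : 0 < r) :
    ∑ u ∈ Q with dist (pos u) x ≤ 2 * r, min 1 (ρ u / r) ≤
      ∑ j ∈ Finset.range (Fintype.card V), (c * 2 ^ s / (j + 1)) ^ (1 / s) := by
  have hpos : ∀ u, 0 < min 1 (ρ u / r) := fun u => lt_min one_pos (div_pos (hρ u) hr)
  refine (sum_le_sum_rpow_of_card_mul_rpow_le (c := c * 2 ^ s) _ _ hs (fun u _ => hpos u)
    fun u hu => ?_).trans ?_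
  · set a := min 1 (ρ u / r) with ha
    have ha0 : 0 < a := hpos u
    have ha1 : a ≤ 1 := min_le_left _ _
    have har : ∀ v, a ≤ min 1 (ρ v / r) → a * r ≤ ρ v := by
      intro v hv
      rw [← le_div_iff₀ hr]
      exact hv.trans (min_le_right _ _)
    have h1 := hg (a * r) (2 * r) u x (by positivity) (by nlinarith) (har u le_rfl)
    have e : 2 * r / (a * r) = 2 / a := by field_simp
    rw [e, Real.div_rpow (by norm_num) ha0.le] at h1
    have h2 : (((Q.filter fun u => dist (pos u) x ≤ 2 * r).filter
        fun v => a ≤ min 1 (ρ v / r)).card : ℝ) ≤ c * (2 ^ s / a ^ s) := by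
      refine le_trans (Nat.cast_le.2 (Finset.card_le_card fun v hv => ?_)) h1
      rw [Finset.mem_filter, Finset.mem_filter] at hv
      exact Finset.mem_filter.2 ⟨Finset.mem_univ _, har v hv.2, hv.1.2⟩
    have has : 0 < a ^ s := Real.rpow_pos_of_pos ha0 _
    calc _ ≤ c * (2 ^ s / a ^ s) * a ^ s := by gcongr
      _ = c * 2 ^ s := by field_simp
  · refine Finset.sum_le_sum_of_subset_of_nonneg ?_ fun j _ _ => by positivity
    exact Finset.range_subset_range.2 (Finset.card_le_univ _)

variable [NormedAddCommGroup E] [NormedSpace ℝ E] [FiniteDimensional ℝ E] {pos : V → E}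

open Classical in
theorem exists_balanced_separator (hinj : Function.Injective pos) (hρ : ∀ v, 0 < ρ v)
    (hg : HasNetGrowth pos ρ c s) (hc : 0 ≤ c) (hs : 0 < s) (hK : 1 ≤ K) (Q : Finset V)
    (hQ : 4 * 9 ^ Module.finrank ℝ E ≤ (Q.card : ℝ)) :
    ∃ S A B : Finset V, S ∪ A ∪ B = Q ∧ Disjoint A B ∧
      (∀ u ∈ A, ∀ v ∈ B, ¬ (netGraph K pos ρ).Adj u v) ∧
      (A.card : ℝ) ≤ (1 - 1 / (4 * 9 ^ Module.finrank ℝ E)) * Q.card ∧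
      (B.card : ℝ) ≤ (1 - 1 / (4 * 9 ^ Module.finrank ℝ E)) * Q.card ∧
      (S.card : ℝ) ≤
        K * ∑ j ∈ Finset.range (Fintype.card V), (c * 2 ^ s / (j + 1)) ^ (1 / s) := by
  set M : ℝ := 9 ^ Module.finrank ℝ E with hM
  have hM1 : 1 ≤ M := one_le_pow₀ (by norm_num)
  have hm0 : (0 : ℝ) ≤ Q.card := by positivity
  -- With this t the doubled ball holds at most M t ≤ |Q|/2 points, while t ≥ |Q|/(4M) points stay
  -- inside the cut; both sides thus lose a constant fraction.
  set t := ⌊(Q.card : ℝ) / (2 * M)⌋₊ with ht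
  have ht1 : (t : ℝ) ≤ Q.card / (2 * M) := Nat.floor_le (by positivity)
  have ht2 : (Q.card : ℝ) / (2 * M) < t + 1 := Nat.lt_floor_add_one _
  have hq : 1 ≤ (Q.card : ℝ) / (4 * M) := by rw [le_div_iff₀ (by positivity)]; linarith
  have hqq : (Q.card : ℝ) / (2 * M) = 2 * (Q.card / (4 * M)) := by field_simp; norm_num
  have h2t : 2 ≤ t := Nat.le_floor (by rw [hqq]; push_cast; linarith)
  have hMt : M * t ≤ Q.card / 2 := by
    calc M * t ≤ M * (Q.card / (2 * M)) := by gcongr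
      _ = _ := by field_simp
  have htQ : t ≤ Q.card := by
    have : (t : ℝ) ≤ Q.card := by nlinarith
    exact_mod_cast this
  obtain ⟨x, r, hr, hin, hout⟩ := exists_dense_ball hinj Q h2t htQ
  obtain ⟨R, hrR, hR2, hS⟩ := exists_radius_card_le Q (fun u => dist (pos u) x)
    (fun u => K * ρ u) hr (fun u _ => mul_nonneg (by linarith) (hρ u).le)
  -- S consists of the inner points whose reach Kρ(u) attains the sphere of radius R, A of the other
  -- inner points, B of the outer points. An edge from u in A has length at most Kρ(u), too short to
  -- get out.
  refine ⟨Q.filter fun u => dist (pos u) x ≤ R ∧ R ≤ dist (pos u) x + K * ρ u,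
    Q.filter fun u => dist (pos u) x ≤ R ∧ ¬ R ≤ dist (pos u) x + K * ρ u,
    Q.filter fun u => ¬ dist (pos u) x ≤ R, ?_, ?_, ?_, ?_, ?_, ?_⟩
  · ext u
    simp only [Finset.mem_union, Finset.mem_filter]
    tauto
  · rw [Finset.disjoint_left]
    intro u hu hu'
    exact (Finset.mem_filter.1 hu').2 (Finset.mem_filter.1 hu).2.1
  · intro u hu v hv huv
    have h1 := (Finset.mem_filter.1 hu).2.2
    have h2 := (Finset.mem_filter.1 hv).2
    have h3 := dist_triangle_left (pos v) x (pos u)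
    have h4 : dist (pos u) (pos v) ≤ K * ρ u := huv.2.1
    linarith
  · have h1 : ((Q.filter fun u => dist (pos u) x ≤ R ∧ ¬ R ≤ dist (pos u) x + K * ρ u).card : ℝ)
        ≤ (Q.filter fun u => dist (pos u) x ≤ 2 * r).card := by
      refine Nat.cast_le.2 (Finset.card_le_card fun u hu => ?_)
      rw [Finset.mem_filter] at hu ⊢
      exact ⟨hu.1, hu.2.1.trans hR2⟩
    have h2 : (1 : ℝ) / (4 * M) ≤ 1 / 2 := by
      rw [div_le_div_iff₀ (by positivity) (by norm_num)]
      linarith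
    nlinarith
  · have h1 : (Q.filter fun u => ¬ dist (pos u) x ≤ R).card + t ≤ Q.card := by
      rw [← Finset.card_filter_add_card_filter_not (s := Q) (fun u => dist (pos u) x ≤ R), add_comm]
      refine Nat.add_le_add_right (hin.trans (Finset.card_le_card fun u hu => ?_)) _
      rw [Finset.mem_filter] at hu ⊢
      exact ⟨hu.1, hu.2.trans hrR⟩
    have h2 : ((Q.filter fun u => ¬ dist (pos u) x ≤ R).card : ℝ) + t ≤ Q.card := by
      exact_mod_cast h1
    have h3 : (1 - 1 / (4 * M)) * (Q.card : ℝ) = Q.card - Q.card / (4 * M) := by ring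
    rw [h3]
    linarith
  · refine hS.trans ?_
    calc ∑ u ∈ Q with dist (pos u) x ≤ 2 * r, min 1 (K * ρ u / r)
        ≤ ∑ u ∈ Q with dist (pos u) x ≤ 2 * r, K * min 1 (ρ u / r) := by
          refine Finset.sum_le_sum fun u _ => ?_
          rw [mul_min_of_nonneg _ _ (by linarith : 0 ≤ K), mul_one, mul_div_assoc]
          exact min_le_min_right _ hK
      _ = K * ∑ u ∈ Q with dist (pos u) x ≤ 2 * r, min 1 (ρ u / r) := by rw [Finset.mul_sum]
      _ ≤ _ := mul_le_mul_of_nonneg_left (hg.sum_min_le hρ hc hs Q x hr) (by linarith)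

/-- Each level of the recursion adds one separator, of size at most W, to the bags and shrinks the
set by the factor θ. Sets too small to be separated become a single bag. -/
theorem hasPathDecomposition_netGraph (hinj : Function.Injective pos) (hρ : ∀ v, 0 < ρ v)
    (hg : HasNetGrowth pos ρ c s) (hc : 0 ≤ c) (hs : 0 < s) (hK : 1 ≤ K) (Q : Finset V) :
    HasPathDecomposition (netGraph K pos ρ) Q (4 * 9 ^ Module.finrank ℝ E +
      (K * ∑ j ∈ Finset.range (Fintype.card V), (c * 2 ^ s / (j + 1)) ^ (1 / s)) *
        (Real.log Q.card / -Real.log (1 - 1 / (4 * 9 ^ Module.finrank ℝ E)))) := by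
  classical
  set W := K * ∑ j ∈ Finset.range (Fintype.card V), (c * 2 ^ s / (j + 1)) ^ (1 / s) with hW
  have hW0 : 0 ≤ W := by
    have : ∀ j : ℕ, 0 ≤ (c * 2 ^ s / ((j : ℝ) + 1)) ^ (1 / s) := fun j => by positivity
    exact mul_nonneg (by linarith) (Finset.sum_nonneg fun j _ => this j)
  set M : ℝ := 9 ^ Module.finrank ℝ E with hM
  have hM1 : 1 ≤ M := one_le_pow₀ (by norm_num)
  set θ := 1 - 1 / (4 * M) with hθ
  have hM4 : 1 / (4 * M) ≤ 1 / 4 := by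
    rw [div_le_div_iff₀ (by positivity) (by norm_num)]
    linarith
  have hM0 : 0 < 1 / (4 * M) := by positivity
  have hθ0 : 3 / 4 ≤ θ := by linarith
  have hθ1 : θ < 1 := by linarith
  have hL : 0 < -Real.log θ := by linarith [Real.log_neg (by linarith) hθ1]
  induction Q using Finset.strongInduction with
  | H Q ih =>
  by_cases hQ : 4 * M ≤ (Q.card : ℝ)
  swap
  · refine (hasPathDecomposition_card Q).mono ?_
    have : 0 ≤ W * (Real.log Q.card / -Real.log θ) :=
      mul_nonneg hW0 (div_nonneg (Real.log_natCast_nonneg _) hL.le)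
    linarith
  obtain ⟨S, A, B, hSAB, hAB, hadj, hA, hB, hS⟩ :=
    exists_balanced_separator hinj hρ hg hc hs hK Q hQ
  have step : ∀ A ⊆ Q, (A.card : ℝ) ≤ θ * Q.card → HasPathDecomposition (netGraph K pos ρ) A
      (4 * M + W * (Real.log Q.card / -Real.log θ) - W) := by
    intro A hAQ hA
    have hne : A ≠ Q := by
      rintro rfl
      nlinarith
    refine (ih A (lt_of_le_of_ne hAQ hne)).mono ?_
    have h1 : Real.log A.card ≤ Real.log Q.card + Real.log θ := by
      rw [add_comm, ← Real.log_mul (by linarith) (by linarith)]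
      -- For empty A the convention log 0 = 0 is harmless because θ|Q| ≥ 1.
      rcases Nat.eq_zero_or_pos A.card with h0 | h0
      · rw [h0, Nat.cast_zero, Real.log_zero]
        exact Real.log_nonneg (by nlinarith)
      · exact Real.log_le_log (by exact_mod_cast h0) hA
    have h2 : Real.log A.card / -Real.log θ ≤ Real.log Q.card / -Real.log θ - 1 := by
      rw [div_le_iff₀ hL, sub_mul, div_mul_cancel₀ _ hL.ne']
      linarith
    nlinarith
  have hsubA : A ⊆ Q := by
    rw [← hSAB]
    exact Finset.subset_union_right.trans Finset.subset_union_left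
  have hsubB : B ⊆ Q := by
    rw [← hSAB]
    exact Finset.subset_union_right
  have := (step A hsubA hA).join (S := S) hAB hadj (step B hsubB hB)
  rw [hSAB] at this
  exact this.mono (by linarith)

theorem pathwidth_netGraph_le (hinj : Function.Injective pos) (hρ : ∀ v, 0 < ρ v)
    (hg : HasNetGrowth pos ρ c s) (hc : 0 ≤ c) (hs : 0 < s) (hK : 1 ≤ K) :
    (pathwidth (netGraph K pos ρ) : ℝ) ≤ 4 * 9 ^ Module.finrank ℝ E +
      (K * ∑ j ∈ Finset.range (Fintype.card V), (c * 2 ^ s / (j + 1)) ^ (1 / s)) *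
        (Real.log (Fintype.card V) / -Real.log (1 - 1 / (4 * 9 ^ Module.finrank ℝ E))) := by
  have h := hasPathDecomposition_netGraph hinj hρ hg hc hs hK Finset.univ
  refine h.pathwidth_le.trans (max_le ?_ le_rfl)
  have hM1 : (1 : ℝ) ≤ 9 ^ Module.finrank ℝ E := one_le_pow₀ (by norm_num)
  have : 0 ≤ (K * ∑ j ∈ Finset.range (Fintype.card V), (c * 2 ^ s / (j + 1)) ^ (1 / s)) *
        (Real.log (Fintype.card V) / -Real.log (1 - 1 / (4 * 9 ^ Module.finrank ℝ E))) := by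
    refine mul_nonneg (mul_nonneg (by linarith) (Finset.sum_nonneg fun j _ => by positivity))
      (div_nonneg (Real.log_natCast_nonneg _) ?_)
    have hM4 : 1 / (4 * (9 : ℝ) ^ Module.finrank ℝ E) ≤ 1 / 4 := by
      rw [div_le_div_iff₀ (by positivity) (by norm_num)]
      linarith
    have hM0 : 0 < 1 / (4 * (9 : ℝ) ^ Module.finrank ℝ E) := by positivity
    linarith [Real.log_neg (by linarith) (by linarith :
      1 - 1 / (4 * (9 : ℝ) ^ Module.finrank ℝ E) < 1)]
  linarith

end netGraph

/-! ## Partial sums of powers -/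

theorem sum_range_add_one_rpow_neg_le {a : ℝ} (ha0 : 0 ≤ a) (ha1 : a < 1) (n : ℕ) :
    ∑ j ∈ Finset.range n, ((j : ℝ) + 1) ^ (-a) ≤ (n : ℝ) ^ (1 - a) / (1 - a) := by
  have h1a : 0 < 1 - a := by linarith
  induction n with
  | zero => simp [Real.zero_rpow h1a.ne']
  | succ n ih =>
    rw [Finset.sum_range_succ]
    refine (add_le_add_left ih _).trans ?_
    push_cast
    have hx : (0 : ℝ) < n + 1 := by positivity
    -- Bernoulli's inequality for the concave power 1 - a, applied to n/(n+1), bounds the new term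
    -- by the increment of x^(1-a)/(1-a).
    have hb := rpow_one_add_le_one_add_mul_self (s := -1 / ((n : ℝ) + 1)) (p := 1 - a)
      (by rw [le_div_iff₀ hx]; linarith [(Nat.cast_nonneg n : (0 : ℝ) ≤ n)]) h1a.le (by linarith)
    have e1 : 1 + -1 / ((n : ℝ) + 1) = n / (n + 1) := by field_simp; ring
    rw [e1, Real.div_rpow (by positivity) hx.le, div_le_iff₀ (by positivity)] at hb
    have e2 : (1 + (1 - a) * (-1 / ((n : ℝ) + 1))) * ((n : ℝ) + 1) ^ (1 - a) =
        ((n : ℝ) + 1) ^ (1 - a) - (1 - a) * ((n : ℝ) + 1) ^ (-a) := by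
      have e3 : ((n : ℝ) + 1) ^ (-a) = ((n : ℝ) + 1) ^ (1 - a) / (n + 1) := by
        rw [show -a = (1 - a) - 1 by ring, Real.rpow_sub_one hx.ne']
      rw [e3]
      field_simp
      ring
    rw [e2] at hb
    rw [div_add' _ _ _ h1a.ne']
    gcongr
    linarith

theorem sum_range_div_rpow_eq {c s : ℝ} (hc : 0 ≤ c) (n : ℕ) :
    ∑ j ∈ Finset.range n, (c / ((j : ℝ) + 1)) ^ (1 / s) =
      c ^ (1 / s) * ∑ j ∈ Finset.range n, ((j : ℝ) + 1) ^ (-(1 / s)) := by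
  rw [Finset.mul_sum]
  refine Finset.sum_congr rfl fun j _ => ?_
  rw [Real.div_rpow hc (by positivity), Real.rpow_neg (by positivity), div_eq_mul_inv]

theorem sum_range_div_rpow_one_le {c : ℝ} (hc : 0 ≤ c) (n : ℕ) :
    ∑ j ∈ Finset.range n, (c / ((j : ℝ) + 1)) ^ (1 / (1 : ℝ)) ≤ c * (1 + Real.log n) := by
  have h := harmonic_le_one_add_log n
  rw [harmonic] at h
  push_cast at h
  rw [sum_range_div_rpow_eq hc, div_one, Real.rpow_one]
  simp only [Real.rpow_neg_one]
  gcongr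

theorem exists_sum_range_div_rpow_le {c s : ℝ} (hc : 0 ≤ c) (hs0 : 0 < s) (hs1 : s < 1) :
    ∃ B, 0 ≤ B ∧ ∀ n : ℕ, ∑ j ∈ Finset.range n, (c / ((j : ℝ) + 1)) ^ (1 / s) ≤ B := by
  have h1 : Summable fun j : ℕ => ((j : ℝ) + 1) ^ (-(1 / s)) := by
    have h := (summable_nat_add_iff 1).2
      (Real.summable_nat_rpow.2 (by
        rw [neg_lt_neg_iff, lt_div_iff₀ hs0]
        linarith : -(1 / s) < -1))
    simpa using h
  refine ⟨c ^ (1 / s) * ∑' j : ℕ, ((j : ℝ) + 1) ^ (-(1 / s)), ?_, fun n => ?_⟩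
  · exact mul_nonneg (by positivity) (tsum_nonneg fun j => by positivity)
  · rw [sum_range_div_rpow_eq hc]
    gcongr
    exact h1.sum_le_tsum _ fun j _ => by positivity

/-! ## Families of bounded fractal dimension -/

section family

variable {d : ℕ} {F : Set (Finset (EuclideanSpace ℝ (Fin d)))}

/-- Makes the set of exponents nonempty, so that a dimension below 1 yields an actual exponent below
1. It is the packing bound with 1 + 2r/η ≤ 3r/η. -/
theorem natCast_mem_fractalExponents : (d : ℝ) ∈ fractalExponents F := by
  classical
  refine ⟨by positivity, 3 ^ d, fun P _ η r hη hr N hN x => ?_⟩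
  have h1 := card_le_of_separated_of_dist_le (id : EuclideanSpace ℝ (Fin d) → _)
    (N.filter fun y => dist y x ≤ r) x hη (by linarith) (fun v hv => (Finset.mem_filter.1 hv).2)
    (fun u hu v hv huv => hN.2.2 u (Finset.mem_filter.1 hu).1 v (Finset.mem_filter.1 hv).1 huv)
  have e : (N : Set (EuclideanSpace ℝ (Fin d))) ∩ Metric.closedBall x r =
      (N.filter fun y => dist y x ≤ r : Finset _) := by
    ext y
    simp
  have hr2 : 2 ≤ r / η := by rwa [le_div_iff₀ hη]
  rw [e, Set.ncard_coe_finset, Real.rpow_natCast, ← mul_pow]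
  refine h1.trans ?_
  rw [finrank_euclideanSpace_fin]
  have : 0 ≤ 2 * r / η := by rw [mul_div_assoc]; linarith
  gcongr
  rw [mul_div_assoc]
  linarith

/-- The points of radius at least η are an η-net in the sense of the definition of exponents. An
exponent may be raised because r/η ≥ 1. -/
theorem exists_hasNetGrowth {s s' : ℝ} (hs : s ∈ fractalExponents F) (hss' : s ≤ s') :
    ∃ c, 0 ≤ c ∧ ∀ (n : ℕ) (p : Fin n ↪ EuclideanSpace ℝ (Fin d)) (ρ : Fin n → ℝ),
      IsNetRadius p ρ → Finset.univ.map p ∈ F → HasNetGrowth p ρ c s' := by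
  classical
  obtain ⟨-, c, hc⟩ := hs
  refine ⟨max c 0, le_max_right _ _, fun n p ρ hρ hF η r w x hη hr hw => ?_⟩
  have hN : IsNet η ((Finset.univ.filter fun v => η ≤ ρ v).map p) (Finset.univ.map p) := by
    refine ⟨Finset.map_subset_map.2 (Finset.subset_univ _), ?_, ?_⟩
    · intro a ha
      obtain ⟨v, -, rfl⟩ := Finset.mem_map.1 ha
      obtain ⟨y, hy, hd⟩ := hρ.cover η w hη hw v
      exact ⟨p y, Finset.mem_map_of_mem _ (by simpa using hy), hd⟩
    · intro a ha b hb hab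
      obtain ⟨u, hu, rfl⟩ := Finset.mem_map.1 ha
      obtain ⟨v, hv, rfl⟩ := Finset.mem_map.1 hb
      simp only [Finset.mem_filter, Finset.mem_univ, true_and] at hu hv
      exact (le_min hu hv).trans (hρ.separated u v fun e => hab (by rw [e]))
  have h := hc _ hF η r hη hr _ hN x
  have e : (((Finset.univ.filter fun v => η ≤ ρ v).map p : Finset _) :
        Set (EuclideanSpace ℝ (Fin d))) ∩ Metric.closedBall x r =
      ((Finset.univ.filter fun v => η ≤ ρ v ∧ dist (p v) x ≤ r).map p : Finset _) := by
    ext y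
    simp only [Finset.coe_map, Set.mem_inter_iff, Set.mem_image, Finset.mem_coe,
      Finset.mem_filter, Finset.mem_univ, true_and, Metric.mem_closedBall]
    constructor
    · rintro ⟨⟨v, hv, rfl⟩, hd⟩
      exact ⟨v, ⟨hv, hd⟩, rfl⟩
    · rintro ⟨v, ⟨hv, hd⟩, rfl⟩
      exact ⟨⟨v, hv, rfl⟩, hd⟩
  rw [e, Set.ncard_coe_finset, Finset.card_map] at h
  have hr1 : 1 ≤ r / η := by rw [le_div_iff₀ hη]; linarith
  refine h.trans ?_
  have h0 : 0 ≤ (r / η) ^ s := by positivity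
  calc c * (r / η) ^ s ≤ max c 0 * (r / η) ^ s := by gcongr; exact le_max_left _ _
    _ ≤ max c 0 * (r / η) ^ s' := by
      gcongr

/-- A bound `H n ≤ C * g n` on the separators of the net graphs yields a bound on their
pathwidths. -/
theorem exists_pathwidth_netGraph_le {s s' K : ℝ} (hs : s ∈ fractalExponents F) (hss' : s ≤ s')
    (hs' : 0 < s') (hK : 1 ≤ K) {g : ℕ → ℝ} {g₀ : ℝ} (hg₀ : 0 < g₀) (hg : ∀ n, 2 ≤ n → g₀ ≤ g n)
    (hsum : ∀ c, 0 ≤ c → ∃ C, 0 ≤ C ∧ ∀ n : ℕ, 2 ≤ n →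
      ∑ j ∈ Finset.range n, (c / ((j : ℝ) + 1)) ^ (1 / s') ≤ C * g n) :
    ∃ B : ℝ, ∀ n : ℕ, 2 ≤ n → ∀ (p : Fin n ↪ EuclideanSpace ℝ (Fin d)) (ρ : Fin n → ℝ),
      IsNetRadius p ρ → Finset.univ.map p ∈ F →
        (pathwidth (netGraph K p ρ) : ℝ) ≤ B * (g n * Real.log n) := by
  obtain ⟨c, hc, hgrow⟩ := exists_hasNetGrowth hs hss'
  obtain ⟨C, hC, hsum⟩ := hsum (c * 2 ^ s') (by positivity)
  set M : ℝ := 4 * 9 ^ d with hM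
  have hM1 : 4 ≤ M := by
    have : (1 : ℝ) ≤ 9 ^ d := one_le_pow₀ (by norm_num)
    linarith
  set L := -Real.log (1 - 1 / M) with hL
  have hL0 : 0 < L := by
    have h1 : 1 / M ≤ 1 / 4 := one_div_le_one_div_of_le (by norm_num) hM1
    have h2 : 0 < 1 / M := by positivity
    have := Real.log_neg (by linarith) (by linarith : 1 - 1 / M < 1)
    linarith
  have hlog2 : 0 < Real.log 2 := Real.log_pos (by norm_num)
  -- The first summand absorbs the additive constant, as g n log n ≥ g₀ log 2; the second comes from
  -- the separators.
  refine ⟨M / (g₀ * Real.log 2) + K * C / L, fun n hn p ρ hρ hF => ?_⟩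
  have h := pathwidth_netGraph_le p.injective hρ.pos_radius (hgrow n p ρ hρ hF) hc hs' hK
  rw [finrank_euclideanSpace_fin, Fintype.card_fin] at h
  refine h.trans ?_
  have hlogn : Real.log 2 ≤ Real.log n := Real.log_le_log (by norm_num) (by exact_mod_cast hn)
  have hlogn0 : 0 ≤ Real.log n := hlog2.le.trans hlogn
  rw [add_mul]
  refine add_le_add ?_ ?_
  · rw [div_mul_eq_mul_div, le_div_iff₀ (by positivity)]
    have := mul_le_mul (hg n hn) hlogn hlog2.le (hg₀.le.trans (hg n hn))
    gcongr
  · calc K * (∑ j ∈ Finset.range n, (c * 2 ^ s' / ((j : ℝ) + 1)) ^ (1 / s')) * (Real.log n / L)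
        ≤ K * (C * g n) * (Real.log n / L) := by
          have := hsum n hn
          gcongr
      _ = _ := by ring

theorem exists_pathwidth_bounds {K δ : ℝ} (hK : 1 ≤ K) (hF : fractalDim F ≤ δ)
    (hδ : 1 ≤ δ → δ ∈ fractalExponents F) :
    ∃ B : ℝ, ∀ n : ℕ, 2 ≤ n → ∀ (p : Fin n ↪ EuclideanSpace ℝ (Fin d)) (ρ : Fin n → ℝ),
      IsNetRadius p ρ → Finset.univ.map p ∈ F →
        (1 < δ → (pathwidth (netGraph K p ρ) : ℝ) ≤ B * ((n : ℝ) ^ (1 - 1 / δ) * Real.log n)) ∧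
        (δ = 1 → (pathwidth (netGraph K p ρ) : ℝ) ≤ B * Real.log n ^ 2) ∧
        (δ < 1 → (pathwidth (netGraph K p ρ) : ℝ) ≤ B * Real.log n) := by
  have hlog2 : 0 < Real.log 2 := Real.log_pos (by norm_num)
  rcases lt_trichotomy δ 1 with h | h | h
  -- This exponent may be 0; replacing it by its maximum with 1/2 makes 1/s meaningful and keeps it
  -- below 1.
  · obtain ⟨s, hs, hs1⟩ := exists_lt_of_csInf_lt ⟨_, natCast_mem_fractalExponents⟩ (hF.trans_lt h)
    obtain ⟨B, hB⟩ := exists_pathwidth_netGraph_le (g := fun _ => 1) hs (le_max_left s (1 / 2))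
      (lt_max_of_lt_right (by norm_num)) hK one_pos (fun _ _ => le_rfl) (fun c hc => by
        obtain ⟨C, hC, h⟩ := exists_sum_range_div_rpow_le hc
          (lt_max_of_lt_right (by norm_num) : 0 < max s (1 / 2)) (max_lt hs1 (by norm_num))
        exact ⟨C, hC, fun n _ => by simpa using h n⟩)
    exact ⟨B, fun n hn p ρ hρ hp => ⟨fun h' => absurd h (by linarith), fun h' => absurd h (by
      linarith), fun _ => by simpa using hB n hn p ρ hρ hp⟩⟩
  · subst h
    obtain ⟨B, hB⟩ := exists_pathwidth_netGraph_le (g := fun n => Real.log n) (hδ le_rfl) le_rfl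
      one_pos hK hlog2 (fun n hn => Real.log_le_log (by norm_num) (by exact_mod_cast hn))
      (fun c hc => by
        refine ⟨c * (1 / Real.log 2 + 1), by positivity, fun n hn => ?_⟩
        refine (sum_range_div_rpow_one_le hc n).trans ?_
        rw [mul_assoc]
        gcongr
        rw [add_mul, one_mul, div_mul_eq_mul_div, one_mul]
        gcongr
        rw [le_div_iff₀ hlog2, one_mul]
        exact Real.log_le_log (by norm_num) (by exact_mod_cast hn))
    exact ⟨B, fun n hn p ρ hρ hp => ⟨fun h' => absurd h' (by norm_num), fun _ => by
      rw [sq]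
      exact hB n hn p ρ hρ hp, fun h' => absurd h' (by norm_num)⟩⟩
  · have hδ1 : 1 / δ < 1 := by
      rw [div_lt_one (by linarith)]
      exact h
    obtain ⟨B, hB⟩ := exists_pathwidth_netGraph_le (g := fun n => (n : ℝ) ^ (1 - 1 / δ))
      (hδ h.le) le_rfl (by linarith) hK one_pos
      (fun n hn => Real.one_le_rpow (by exact_mod_cast (by omega : 1 ≤ n)) (by linarith))
      (fun c hc => by
        refine ⟨c ^ (1 / δ) * (1 / (1 - 1 / δ)), mul_nonneg (by positivity)
          (div_nonneg zero_le_one (by linarith)), fun n hn => ?_⟩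
        rw [sum_range_div_rpow_eq hc, mul_assoc]
        gcongr
        refine (sum_range_add_one_rpow_neg_le (by positivity) hδ1 n).trans ?_
        rw [one_div_mul_eq_div])
    exact ⟨B, fun n hn p ρ hρ hp => ⟨fun _ => hB n hn p ρ hρ hp, fun h' => absurd h (by
      linarith), fun h' => absurd h (by linarith)⟩⟩

end family

namespace RealRAM

/-! ## Total correctness of programs -/

/-- Started in memory `m`, the program `p` halts after at most `T` steps in a memory
satisfying `Q`. -/
def Program.Ensures (p : Program) (T : ℕ) (m : Memory) (Q : Memory → Prop) : Prop :=
  ∃ (m' : Memory) (t : ℕ), p.Runs m m' t ∧ t ≤ T ∧ Q m'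

section ensures

variable {p q : Program} {T T' : ℕ} {m : Memory} {Q Q' : Memory → Prop}

theorem Program.Ensures.mono (h : p.Ensures T m Q) (hT : T ≤ T') (hQ : ∀ m', Q m' → Q' m') :
    p.Ensures T' m Q' := by
  obtain ⟨m', t, h1, h2, h3⟩ := h
  exact ⟨m', t, h1, h2.trans hT, hQ _ h3⟩

theorem ensures_skip (h : Q m) : Program.skip.Ensures 1 m Q :=
  ⟨_, _, .skip m, le_rfl, h⟩

theorem ensures_setNat {a : ℕ} {i e : NExp} (h : Q (m.writeNat a (i.eval m) (e.eval m))) :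
    (Program.setNat a i e).Ensures 1 m Q :=
  ⟨_, _, .setNat m a i e, le_rfl, h⟩

theorem ensures_setReal {a : ℕ} {i : NExp} {e : RExp}
    (h : Q (m.writeReal a (i.eval m) (e.eval m))) : (Program.setReal a i e).Ensures 1 m Q :=
  ⟨_, _, .setReal m a i e, le_rfl, h⟩

theorem Program.Ensures.seq (h : p.Ensures T m fun m' => q.Ensures T' m' Q) :
    (Program.seq p q).Ensures (T + T') m Q := by
  obtain ⟨m', t, h1, h2, m'', t', h3, h4, h5⟩ := h
  exact ⟨m'', t + t', .seq h1 h3, add_le_add h2 h4, h5⟩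

theorem ensures_ite {b : BExp} (h : b.Holds m → p.Ensures T m Q)
    (h' : ¬ b.Holds m → q.Ensures T m Q) : (Program.ite b p q).Ensures (T + 1) m Q := by
  by_cases hb : b.Holds m
  · obtain ⟨m', t, h1, h2, h3⟩ := h hb
    exact ⟨m', t + 1, .ite_true hb h1, by omega, h3⟩
  · obtain ⟨m', t, h1, h2, h3⟩ := h' hb
    exact ⟨m', t + 1, .ite_false hb h1, by omega, h3⟩

/-- Entry `0` of the natural number array `a`. -/
abbrev NExp.reg (a : ℕ) : NExp := .get a (.lit 0)

/-- Run `p` with the register `a` going from `s` to `n - 1`, where the register `b`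
contains `n`. -/
def Program.forRange (a b s : ℕ) (p : Program) : Program :=
  .seq (.setNat a (.lit 0) (.lit s))
    (.loop (.natLE (.add (.reg a) (.lit 1)) (.reg b))
      (.seq p (.setNat a (.lit 0) (.add (.reg a) (.lit 1)))))

/-- A round costs the body, an increment and a test; the final 2 is the initialization and the
failing test. The index max s n covers s > n, where the body never runs: the traversal starts at 1
even without points. -/
theorem ensures_forRange {a b s n : ℕ} (I : ℕ → Memory → Prop) (hI : ∀ k m, I k m → m.nat b 0 = n)
    (h0 : I s (m.writeNat a 0 s))
    (hstep : ∀ k m, s ≤ k → k < n → m.nat a 0 = k → I k m →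
      p.Ensures T m fun m' => m'.nat a 0 = k ∧ I (k + 1) (m'.writeNat a 0 (k + 1))) :
    (Program.forRange a b s p).Ensures (n * (T + 2) + 2) m (I (max s n)) := by
  have key : ∀ j k m, n - k = j → s ≤ k → m.nat a 0 = k → I k m →
      (Program.loop (.natLE (.add (.reg a) (.lit 1)) (.reg b))
        (.seq p (.setNat a (.lit 0) (.add (.reg a) (.lit 1))))).Ensures (j * (T + 2) + 1) m
          (I (max k n)) := by
    intro j
    induction j with
    | zero =>
      intro k m hj hs hk hm
      refine ⟨m, 1, .loop_false ?_, by omega, by rwa [max_eq_left (by omega)]⟩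
      simp only [BExp.Holds, NExp.eval, hk, hI k m hm]
      omega
    | succ j ih =>
      intro k m hj hs hk hm
      obtain ⟨m', t, h1, h2, h3, h4⟩ := hstep k m hs (by omega) hk hm
      obtain ⟨m'', t', h5, h6, h7⟩ := ih (k + 1) (m'.writeNat a 0 (k + 1)) (by omega) (by omega)
        (by simp [Memory.writeNat]) h4
      have hset := Program.Runs.setNat m' a (.lit 0) (.add (.reg a) (.lit 1))
      simp only [NExp.eval, h3] at hset
      refine ⟨m'', t + 1 + t' + 1, .loop_true ?_ (.seq h1 hset) h5, ?_, ?_⟩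
      · simp only [BExp.Holds, NExp.eval, hk, hI k m hm]
        omega
      · rw [add_mul]
        omega
      · rwa [max_eq_right (by omega : k + 1 ≤ n), ← max_eq_right (by omega : k ≤ n)] at h7
  obtain ⟨m', t, h1, h2, h3⟩ := key (n - s) s (m.writeNat a 0 s) rfl le_rfl
    (by simp [Memory.writeNat]) h0
  refine ⟨m', 1 + t, .seq (.setNat m a (.lit 0) (.lit s)) h1, ?_, h3⟩
  have : (n - s) * (T + 2) ≤ n * (T + 2) := Nat.mul_le_mul_right _ (Nat.sub_le _ _)
  omega

end ensures

theorem writeNat_nat (m : Memory) (a i v b k : ℕ) :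
    (m.writeNat a i v).nat b k = if b = a ∧ k = i then v else m.nat b k := by
  by_cases hb : b = a
  · subst hb
    by_cases hk : k = i <;> simp [Memory.writeNat, hk]
  · simp [Memory.writeNat, hb]

@[simp] theorem writeNat_real (m : Memory) (a i v : ℕ) : (m.writeNat a i v).real = m.real := rfl

@[simp] theorem writeReal_nat (m : Memory) (a i : ℕ) (v : ℝ) :
    (m.writeReal a i v).nat = m.nat := rfl

theorem writeReal_real (m : Memory) (a i : ℕ) (v : ℝ) (b k : ℕ) :
    (m.writeReal a i v).real b k = if b = a ∧ k = i then v else m.real b k := by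
  by_cases hb : b = a
  · subst hb
    by_cases hk : k = i <;> simp [Memory.writeReal, hk]
  · simp [Memory.writeReal, hb]

/-! ## Farthest-first traversal -/

/-- The state of a farthest-first traversal of `0, …, n - 1` with the squared distances `D`:
the points in `C` have been visited, `M i` is the squared distance of `i` to `C`, and `L` are the
squared radii of the points of `C`. -/
structure GreedyState (D : ℕ → ℕ → ℝ) (n : ℕ) (C : Finset ℕ) (M L : ℕ → ℝ) : Prop where
  subset : ∀ j ∈ C, j < n
  zero_mem : 0 ∈ C
  exists_eq : ∀ i < n, ∃ j ∈ C, M i = D i j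
  le : ∀ i < n, ∀ j ∈ C, M i ≤ D i j
  pos : ∀ j ∈ C, 0 < L j
  le_zero : ∀ j ∈ C, L j ≤ L 0
  wide : ∀ i < n, D i 0 ≤ L 0
  separated : ∀ i ∈ C, ∀ j ∈ C, i ≠ j → min (L i) (L j) ≤ D i j
  cover : ∀ r ≤ L 0, (∀ y ∈ C, r ≤ L y) ∨ ∀ x < n, ∃ y ∈ C, r ≤ L y ∧ D x y ≤ r

/-- The farthest point b has distance at least M b to all of C, which gives separation. For a level
r, either all radii so far are at least r, or C already contains a cover of level r; the switch
happens when M b < r, at which moment C itself is the cover. Monotonicity of the radii is not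
needed. -/
theorem GreedyState.insert {D : ℕ → ℕ → ℝ} {n : ℕ} {C : Finset ℕ} {M L M' L' : ℕ → ℝ}
    (h : GreedyState D n C M L) (hD0 : ∀ i, D i i = 0) (hDs : ∀ i j, D i j = D j i)
    (hDp : ∀ i < n, ∀ j < n, i ≠ j → 0 < D i j) (hC : C.card < n) {b : ℕ} (hb : b < n)
    (hmax : ∀ i < n, M i ≤ M b) (hM' : ∀ i < n, M' i = min (M i) (D i b)) (hLb : L' b = M b)
    (hL : ∀ i, i ≠ b → L' i = L i) :
    b ∉ C ∧ GreedyState D n (insert b C) M' L' := by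
  have hMb : 0 < M b := by
    obtain ⟨i, hi, hiC⟩ := Finset.exists_mem_notMem_of_card_lt_card
      (by rwa [Finset.card_range] : C.card < (Finset.range n).card)
    have hi := Finset.mem_range.1 hi
    obtain ⟨j, hj, hij⟩ := h.exists_eq i hi
    refine lt_of_lt_of_le ?_ (hmax i hi)
    rw [hij]
    exact hDp i hi j (h.subset j hj) fun e => hiC (e ▸ hj)
  have hbC : b ∉ C := by
    intro hbC
    have := h.le b hb b hbC
    rw [hD0] at this
    linarith
  have hLC : ∀ i ∈ C, L' i = L i := fun i hi => hL i fun e => hbC (e ▸ hi)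
  have hL0 : L' 0 = L 0 := hLC 0 h.zero_mem
  have hb0 : M b ≤ L 0 := (h.le b hb 0 h.zero_mem).trans (h.wide b hb)
  refine ⟨hbC, ?_, ?_, ?_, ?_, ?_, ?_, ?_, ?_, ?_⟩
  · intro j hj
    rcases Finset.mem_insert.1 hj with rfl | hj
    exacts [hb, h.subset j hj]
  · exact Finset.mem_insert_of_mem h.zero_mem
  · intro i hi
    rw [hM' i hi]
    rcases le_total (M i) (D i b) with h1 | h1
    · obtain ⟨j, hj, hij⟩ := h.exists_eq i hi
      exact ⟨j, Finset.mem_insert_of_mem hj, by rw [min_eq_left h1, hij]⟩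
    · exact ⟨b, Finset.mem_insert_self _ _, min_eq_right h1⟩
  · intro i hi j hj
    rw [hM' i hi]
    rcases Finset.mem_insert.1 hj with rfl | hj
    exacts [min_le_right _ _, (min_le_left _ _).trans (h.le i hi j hj)]
  · intro j hj
    rcases Finset.mem_insert.1 hj with rfl | hj
    · rwa [hLb]
    · rw [hLC j hj]
      exact h.pos j hj
  · intro j hj
    rw [hL0]
    rcases Finset.mem_insert.1 hj with rfl | hj
    · rwa [hLb]
    · rw [hLC j hj]
      exact h.le_zero j hj
  · rw [hL0]
    exact h.wide
  · intro i hi j hj hij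
    rcases Finset.mem_insert.1 hi with hi' | hi' <;> rcases Finset.mem_insert.1 hj with hj' | hj'
    · exact absurd (hi'.trans hj'.symm) hij
    · rw [hi', hLb]
      exact (min_le_left _ _).trans (h.le b hb j hj')
    · rw [hj', hLb, hDs]
      exact (min_le_right _ _).trans (h.le b hb i hi')
    · rw [hLC i hi', hLC j hj']
      exact h.separated i hi' j hj' hij
  · intro r hr
    rw [hL0] at hr
    rcases h.cover r hr with h1 | h1
    · rcases le_or_gt r (M b) with h2 | h2
      · left
        intro y hy
        rcases Finset.mem_insert.1 hy with rfl | hy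
        · rwa [hLb]
        · rw [hLC y hy]
          exact h1 y hy
      · right
        intro x hx
        obtain ⟨y, hy, hxy⟩ := h.exists_eq x hx
        refine ⟨y, Finset.mem_insert_of_mem hy, by rw [hLC y hy]; exact h1 y hy, ?_⟩
        rw [← hxy]
        exact (hmax x hx).trans h2.le
    · right
      intro x hx
      obtain ⟨y, hy, h2, h3⟩ := h1 x hx
      exact ⟨y, Finset.mem_insert_of_mem hy, by rwa [hLC y hy], h3⟩

theorem GreedyState.isNetRadius {X : Type*} [PseudoMetricSpace X] {D : ℕ → ℕ → ℝ} {n : ℕ}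
    {C : Finset ℕ} {M L : ℕ → ℝ} (h : GreedyState D n C M L) (hC : n ≤ C.card) (p : Fin n → X)
    (hD : ∀ i j : Fin n, D i j = dist (p i) (p j) ^ 2) :
    IsNetRadius p fun i => √(L i) := by
  have hmem : ∀ i : Fin n, (i : ℕ) ∈ C := by
    have : C = Finset.range n := Finset.eq_of_subset_of_card_le
      (fun j hj => Finset.mem_range.2 (h.subset j hj)) (by rwa [Finset.card_range])
    intro i
    rw [this]
    exact Finset.mem_range.2 i.2
  refine ⟨fun i => Real.sqrt_pos.2 (h.pos i (hmem i)), ?_, ?_, ?_⟩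
  · intro u v huv
    have := h.separated u (hmem u) v (hmem v) fun e => huv (Fin.ext e)
    rw [hD] at this
    rcases min_le_iff.1 this with h1 | h1
    · exact min_le_of_left_le (Real.sqrt_le_iff.2 ⟨dist_nonneg, h1⟩)
    · exact min_le_of_right_le (Real.sqrt_le_iff.2 ⟨dist_nonneg, h1⟩)
  · intro r w hr hrw v
    rw [Real.le_sqrt' hr] at hrw
    rcases h.cover (r ^ 2) (hrw.trans (h.le_zero w (hmem w))) with h1 | h1
    -- All radii are at least r, so each point covers itself.
    · exact ⟨v, (Real.le_sqrt' hr).2 (h1 v (hmem v)), by simpa using hr.le⟩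
    · obtain ⟨y, hy, h2, h3⟩ := h1 v v.2
      lift y to Fin n using h.subset y hy
      refine ⟨y, (Real.le_sqrt' hr).2 h2, ?_⟩
      rw [hD] at h3
      exact (sq_le_sq₀ dist_nonneg hr.le).1 h3
  · intro u v
    let z : Fin n := ⟨0, u.pos⟩
    refine ⟨z, ?_⟩
    have key : ∀ i : Fin n, dist (p i) (p z) ≤ √(L 0) := by
      intro i
      refine Real.le_sqrt_of_sq_le ?_
      rw [← hD]
      exact h.wide i i.2
    have := dist_triangle_right (p u) (p v) (p z)
    have h1 := key u
    have h2 := key v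
    change _ ≤ 2 * √(L 0)
    linarith

end RealRAM

namespace RealRAM

/-! ## The program -/

/-- The squared distance of the points `e` and `f`, computed from the first `d` coordinates. -/
def sqDist : ℕ → NExp → NExp → RExp
  | 0, _, _ => .lit 0
  | d + 1, e, f =>
    .add (sqDist d e f) (.mul (.sub (.get d e) (.get d f)) (.sub (.get d e) (.get d f)))

/-- The squared distance of the points `i` and `j` in memory `m`. -/
def Memory.sqDist (m : Memory) (d i j : ℕ) : ℝ :=
  ∑ l ∈ Finset.range d, (m.real l i - m.real l j) * (m.real l i - m.real l j)

theorem eval_sqDist {m₀ m : Memory} {d : ℕ} (h : ∀ l < d, m.real l = m₀.real l) (e f : NExp) :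
    (sqDist d e f).eval m = m₀.sqDist d (e.eval m) (f.eval m) := by
  induction d with
  | zero => simp [sqDist, RExp.eval, Memory.sqDist]
  | succ d ih =>
    rw [sqDist, RExp.eval, ih fun l hl => h l (by omega), Memory.sqDist, Memory.sqDist,
      Finset.sum_range_succ]
    simp [RExp.eval, h d (by omega)]

/-- Register `3` contains the number of points, and the coordinates are those of `m₀`. -/
structure HoldsInput (m₀ : Memory) (d n : ℕ) (m : Memory) : Prop where
  size : m.nat 3 0 = n
  coord : ∀ l < d, m.real l = m₀.real l

theorem HoldsInput.writeNat {m₀ m : Memory} {d n : ℕ} (h : HoldsInput m₀ d n m) {a : ℕ}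
    (ha : a ≠ 3) (i v : ℕ) : HoldsInput m₀ d n (m.writeNat a i v) :=
  ⟨by rw [writeNat_nat, if_neg (by omega), h.size], h.coord⟩

theorem HoldsInput.writeReal {m₀ m : Memory} {d n : ℕ} (h : HoldsInput m₀ d n m) {a : ℕ}
    (ha : d ≤ a) (i : ℕ) (v : ℝ) : HoldsInput m₀ d n (m.writeReal a i v) :=
  ⟨h.size, fun l hl => by
    rw [← h.coord l hl]
    funext k
    rw [writeReal_real, if_neg (by omega)]⟩

/-- Visit point `0`. -/
def initProgram (d : ℕ) : Program :=
  .seq (.setReal (d + 1) (.lit 0) (.lit 1))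
    (.forRange 4 3 0
      (.seq (.setReal d (.reg 4) (sqDist d (.reg 4) (.lit 0)))
        (.setReal (d + 1) (.lit 0) (.add (.get (d + 1) (.lit 0)) (.get d (.reg 4))))))

/-- The squared radius of point 0 is 1 plus the sum of all squared distances to it: positive even
for one point, and at least each of them. Real array `d` stores the squared distances to the visited
set, array `d + 1` the squared radii. -/
theorem ensures_initProgram {m₀ m : Memory} {d n : ℕ} (h : HoldsInput m₀ d n m) :
    (initProgram d).Ensures (n * 4 + 3) m fun m' => HoldsInput m₀ d n m' ∧
      (0 < n → GreedyState (m₀.sqDist d) n {0} (m'.real d) (m'.real (d + 1))) := by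
  have hD0 : ∀ i j, 0 ≤ m₀.sqDist d i j := fun i j =>
    Finset.sum_nonneg fun l _ => mul_self_nonneg _
  let I : ℕ → Memory → Prop := fun k m => HoldsInput m₀ d n m ∧
    (∀ i < k, m.real d i = m₀.sqDist d i 0 ∧ m₀.sqDist d i 0 ≤ m.real (d + 1) 0) ∧
    1 ≤ m.real (d + 1) 0
  have hloop : (initProgram d).Ensures (1 + (n * (2 + 2) + 2)) m (I (max 0 n)) := by
    refine Program.Ensures.seq (ensures_setReal ?_)
    refine ensures_forRange I (fun k m hm => hm.1.size) ⟨?_, ?_, ?_⟩ ?_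
    · exact (h.writeReal (by omega) _ _).writeNat (by omega) _ _
    · intro i hi
      omega
    · simp [writeReal_real, NExp.eval, RExp.eval]
    · intro k m hs hk hkm hI
      refine Program.Ensures.seq (T := 1) (T' := 1) (ensures_setReal (ensures_setReal ?_))
      obtain ⟨h1, h2, h3⟩ := hI
      have e : (sqDist d (.reg 4) (.lit 0)).eval m = m₀.sqDist d k 0 := by
        rw [eval_sqDist h1.coord]
        simp [NExp.eval, hkm]
      refine ⟨by simpa using hkm,
        ((h1.writeReal (by omega) _ _).writeReal (by omega) _ _).writeNat (by omega) _ _, ?_, ?_⟩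
      · intro i hi
        have hk0 := hD0 k 0
        simp only [writeNat_real, writeReal_real, writeReal_nat, e, RExp.eval, NExp.eval, hkm]
        rcases Nat.lt_succ_iff_lt_or_eq.1 hi with hi | rfl
        · obtain ⟨h4, h5⟩ := h2 i hi
          simp [hi.ne, h4]
          linarith
        · simp
          linarith
      · have hk0 := hD0 k 0
        simp only [writeNat_real, writeReal_real, writeReal_nat, e, RExp.eval, NExp.eval, hkm]
        simp
        linarith
  refine hloop.mono (by omega) fun m' ⟨h1, h2, h3⟩ => ⟨h1, fun hn => ?_⟩
  rw [Nat.zero_max] at h2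
  constructor
  · simpa using hn
  · simp
  · intro i hi
    exact ⟨0, by simp, (h2 i hi).1⟩
  · intro i hi j hj
    rw [Finset.mem_singleton.1 hj]
    exact (h2 i hi).1.le
  · intro j hj
    rw [Finset.mem_singleton.1 hj]
    linarith
  · intro j hj
    rw [Finset.mem_singleton.1 hj]
  · exact fun i hi => (h2 i hi).2
  · intro i hi j hj hij
    exact absurd ((Finset.mem_singleton.1 hi).trans (Finset.mem_singleton.1 hj).symm) hij
  · intro r hr
    left
    intro y hy
    rwa [Finset.mem_singleton.1 hy]

/-- Put a farthest point into register `6`. -/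
def argmaxProgram (d : ℕ) : Program :=
  .seq (.setNat 6 (.lit 0) (.lit 0))
    (.forRange 4 3 0
      (.ite (.realLE (.get d (.reg 6)) (.get d (.reg 4))) (.setNat 6 (.lit 0) (.reg 4)) .skip))

theorem ensures_argmaxProgram {m : Memory} {d n : ℕ} (hn : 0 < n) (h : m.nat 3 0 = n) :
    (argmaxProgram d).Ensures (n * 4 + 3) m fun m' => m'.real = m.real ∧ m'.nat 3 0 = n ∧
      m'.nat 7 0 = m.nat 7 0 ∧ m'.nat 6 0 < n ∧ ∀ i < n, m.real d i ≤ m.real d (m'.nat 6 0) := by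
  let I : ℕ → Memory → Prop := fun k m' => m'.real = m.real ∧ m'.nat 3 0 = n ∧
      m'.nat 7 0 = m.nat 7 0 ∧ m'.nat 6 0 < n ∧ ∀ i < k, m.real d i ≤ m.real d (m'.nat 6 0)
  have hloop : (argmaxProgram d).Ensures (1 + (n * (2 + 2) + 2)) m (I (max 0 n)) := by
    refine Program.Ensures.seq (ensures_setNat ?_)
    refine ensures_forRange I (fun k m hm => hm.2.1) ?_ ?_
    · exact ⟨rfl, by simpa [writeNat_nat], by simp [writeNat_nat],
        by simpa [writeNat_nat, NExp.eval], fun i hi => by omega⟩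
    · intro k m' hs hk hkm ⟨h1, h2, h3, h4, h5⟩
      refine ensures_ite (T := 1) (fun hb => ensures_setNat ?_) (fun hb => ensures_skip ?_)
      · simp only [BExp.Holds, RExp.eval, NExp.eval, hkm, h1] at hb
        refine ⟨by simp [writeNat_nat, hkm], h1, by simp [writeNat_nat, h2],
          by simp [writeNat_nat, h3], by simp [writeNat_nat, NExp.eval, hkm, hk], ?_⟩
        intro i hi
        simp only [writeNat_nat, NExp.eval, hkm]
        rcases Nat.lt_succ_iff_lt_or_eq.1 hi with hi | rfl
        · simpa using (h5 i hi).trans hb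
        · simp
      · simp only [BExp.Holds, RExp.eval, NExp.eval, hkm, h1, not_le] at hb
        refine ⟨hkm, h1, by simp [writeNat_nat, h2],
          by simp [writeNat_nat, h3], by simp [writeNat_nat, h4], ?_⟩
        intro i hi
        simp only [writeNat_nat]
        rcases Nat.lt_succ_iff_lt_or_eq.1 hi with hi | rfl
        · simpa using h5 i hi
        · simpa using hb.le
  refine hloop.mono (by omega) fun m' hm' => ?_
  rwa [Nat.zero_max] at hm'

/-- Visit the point in register `6`. -/
def visitProgram (d : ℕ) : Program :=
  .seq (.setReal (d + 1) (.reg 6) (.get d (.reg 6)))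
    (.forRange 4 3 0
      (.ite (.realLE (sqDist d (.reg 4) (.reg 6)) (.get d (.reg 4)))
        (.setReal d (.reg 4) (sqDist d (.reg 4) (.reg 6))) .skip))

/-- The radius is recorded before the loop, which overwrites the distance of the visited point.
Register 7 is tracked because it is the counter of the surrounding loop. -/
theorem ensures_visitProgram {m₀ m : Memory} {d n : ℕ} (h : HoldsInput m₀ d n m) :
    (visitProgram d).Ensures (n * 4 + 3) m fun m' => HoldsInput m₀ d n m' ∧
      m'.nat 7 0 = m.nat 7 0 ∧
      (∀ i < n, m'.real d i = min (m.real d i) (m₀.sqDist d i (m.nat 6 0))) ∧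
      ∀ i, m'.real (d + 1) i =
        if i = m.nat 6 0 then m.real d (m.nat 6 0) else m.real (d + 1) i := by
  let I : ℕ → Memory → Prop := fun k m' => HoldsInput m₀ d n m' ∧ m'.nat 6 0 = m.nat 6 0 ∧
      m'.nat 7 0 = m.nat 7 0 ∧
      (∀ i < k, m'.real d i = min (m.real d i) (m₀.sqDist d i (m.nat 6 0))) ∧
      (∀ i, k ≤ i → m'.real d i = m.real d i) ∧
      ∀ i, m'.real (d + 1) i =
        if i = m.nat 6 0 then m.real d (m.nat 6 0) else m.real (d + 1) i
  have hloop : (visitProgram d).Ensures (1 + (n * (2 + 2) + 2)) m (I (max 0 n)) := by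
    refine Program.Ensures.seq (ensures_setReal ?_)
    refine ensures_forRange I (fun k m hm => hm.1.size) ?_ ?_
    · refine ⟨(h.writeReal (by omega) _ _).writeNat (by omega) _ _, by simp [writeNat_nat],
        by simp [writeNat_nat], fun i hi => by omega, fun i _ => ?_, fun i => ?_⟩
      · simp [writeReal_real]
      · simp [writeReal_real, NExp.eval, RExp.eval]
    · intro k m' hs hk hkm ⟨h1, h2, h3, h4, h5, h6⟩
      have e : (sqDist d (.reg 4) (.reg 6)).eval m' = m₀.sqDist d k (m.nat 6 0) := by
        rw [eval_sqDist h1.coord]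
        simp [NExp.eval, hkm, h2]
      refine ensures_ite (T := 1) (fun hb => ensures_setReal ?_) (fun hb => ensures_skip ?_)
      · simp only [BExp.Holds, RExp.eval, NExp.eval, hkm, e, h5 k le_rfl] at hb
        refine ⟨hkm, (h1.writeReal (by omega) _ _).writeNat (by omega) _ _,
          by simp [writeNat_nat, h2], by simp [writeNat_nat, h3], ?_, ?_, ?_⟩
        · intro i hi
          simp only [writeNat_real, writeReal_real, NExp.eval, hkm, e]
          rcases Nat.lt_succ_iff_lt_or_eq.1 hi with hi | rfl
          · simp [hi.ne, h4 i hi]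
          · simp [hb]
        · intro i hi
          simp only [writeNat_real, writeReal_real, NExp.eval, hkm, e]
          rw [if_neg (by omega), h5 i (by omega)]
        · intro i
          simp [writeReal_real, h6 i]
      · simp only [BExp.Holds, RExp.eval, NExp.eval, hkm, e, h5 k le_rfl, not_le] at hb
        refine ⟨hkm, h1.writeNat (by omega) _ _,
          by simp [writeNat_nat, h2], by simp [writeNat_nat, h3], ?_, ?_, h6⟩
        · intro i hi
          rw [writeNat_real]
          rcases Nat.lt_succ_iff_lt_or_eq.1 hi with hi | rfl
          · exact h4 i hi
          · rw [h5 i le_rfl, min_eq_left hb.le]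
        · intro i hi
          exact h5 i (by omega)
  refine hloop.mono (by omega) fun m' ⟨h1, _, h3, h4, _, h6⟩ => ?_
  rw [Nat.zero_max] at h4
  exact ⟨h1, h3, h4, h6⟩

/-- Compute the squared radii of a farthest-first traversal in the real array `d + 1`. -/
def greedyProgram (d : ℕ) : Program :=
  .seq (initProgram d) (.forRange 7 3 1 (.seq (argmaxProgram d) (visitProgram d)))

theorem ensures_greedyProgram {m₀ m : Memory} {d n : ℕ} (h : HoldsInput m₀ d n m)
    (hinj : ∀ i < n, ∀ j < n, i ≠ j → 0 < m₀.sqDist d i j) :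
    (greedyProgram d).Ensures (n * (n * 8 + 12) + 5) m fun m' => HoldsInput m₀ d n m' ∧
      (0 < n → ∃ C : Finset ℕ, n ≤ C.card ∧
        GreedyState (m₀.sqDist d) n C (m'.real d) (m'.real (d + 1))) := by
  have hD0 : ∀ i, m₀.sqDist d i i = 0 := fun i => by simp [Memory.sqDist]
  have hDs : ∀ i j, m₀.sqDist d i j = m₀.sqDist d j i := fun i j =>
    Finset.sum_congr rfl fun l _ => by ring
  let I : ℕ → Memory → Prop := fun k m => HoldsInput m₀ d n m ∧
      (0 < n → ∃ C : Finset ℕ, C.card = k ∧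
        GreedyState (m₀.sqDist d) n C (m.real d) (m.real (d + 1)))
  have hloop : (greedyProgram d).Ensures
      ((n * 4 + 3) + (n * ((n * 4 + 3) + (n * 4 + 3) + 2) + 2)) m (I (max 1 n)) := by
    refine Program.Ensures.seq ((ensures_initProgram h).mono le_rfl fun m₁ ⟨h1, h2⟩ => ?_)
    refine ensures_forRange I (fun k m hm => hm.1.size) ?_ ?_
    · exact ⟨h1.writeNat (by omega) _ _, fun hn => ⟨{0}, rfl, h2 hn⟩⟩
    · intro k m₂ hs hk hkm ⟨h3, h4⟩
      have hn : 0 < n := by omega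
      refine Program.Ensures.seq ((ensures_argmaxProgram hn h3.size).mono le_rfl ?_)
      intro m₃ ⟨h5, h6, h7, h8, h9⟩
      have h10 : HoldsInput m₀ d n m₃ := ⟨h6, by rw [h5]; exact h3.coord⟩
      refine (ensures_visitProgram h10).mono le_rfl ?_
      intro m₄ ⟨h11, h12, h13, h14⟩
      refine ⟨by rw [h12, h7, hkm], h11.writeNat (by omega) _ _, fun hn => ?_⟩
      obtain ⟨C, hC, hCg⟩ := h4 hn
      rw [h5] at h13 h14
      obtain ⟨h15, h16⟩ := hCg.insert (L' := m₄.real (d + 1)) hD0 hDs hinj (by omega) h8 h9 h13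
        (by rw [h14, if_pos rfl]) (fun i hi => by rw [h14, if_neg hi])
      exact ⟨_, by rw [Finset.card_insert_of_notMem h15, hC], h16⟩
  refine hloop.mono (by ring_nf; omega) fun m' ⟨h1, h2⟩ => ⟨h1, fun hn => ?_⟩
  obtain ⟨C, hC, hCg⟩ := h2 hn
  exact ⟨C, by omega, hCg⟩

/-- The test for an edge between the points in registers `4` and `5`. -/
def edgeTest (d K : ℕ) : BExp :=
  .and (.realLE (sqDist d (.reg 4) (.reg 5)) (.mul (.lit (K ^ 2)) (.get (d + 1) (.reg 4))))
    (.realLE (sqDist d (.reg 4) (.reg 5)) (.mul (.lit (K ^ 2)) (.get (d + 1) (.reg 5))))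

/-- Append the pair of registers `4` and `5` to the output. -/
def appendEdge : Program :=
  .seq (.setNat 1 (.reg 0) (.reg 4))
    (.seq (.setNat 2 (.reg 0) (.reg 5)) (.setNat 0 (.lit 0) (.add (.reg 0) (.lit 1))))

/-- Output all edges. -/
def edgeProgram (d K : ℕ) : Program :=
  .seq (.setNat 0 (.lit 0) (.lit 0))
    (.forRange 4 3 0 (.forRange 5 3 0 (.ite (edgeTest d K) appendEdge .skip)))

/-- The pair `i, j` is in the output list. -/
def Listed (m : Memory) (i j : ℕ) : Prop := ∃ e < m.nat 0 0, m.nat 1 e = i ∧ m.nat 2 e = j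

theorem listed_congr {m m' : Memory} (h0 : m'.nat 0 0 = m.nat 0 0) (h1 : m'.nat 1 = m.nat 1)
    (h2 : m'.nat 2 = m.nat 2) (i j : ℕ) : Listed m' i j ↔ Listed m i j := by
  simp only [Listed, h0, h1, h2]

theorem listed_writeNat {m : Memory} {a : ℕ} (ha : 3 ≤ a) (k v i j : ℕ) :
    Listed (m.writeNat a k v) i j ↔ Listed m i j := by
  refine listed_congr ?_ ?_ ?_ i j
  · rw [writeNat_nat, if_neg (by omega)]
  · funext e
    rw [writeNat_nat, if_neg (by omega)]
  · funext e
    rw [writeNat_nat, if_neg (by omega)]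

theorem ensures_appendEdge (m : Memory) :
    appendEdge.Ensures 3 m fun m' => m'.real = m.real ∧ (∀ a, 3 ≤ a → m'.nat a = m.nat a) ∧
      ∀ i j, Listed m' i j ↔ Listed m i j ∨ (i = m.nat 4 0 ∧ j = m.nat 5 0) := by
  refine Program.Ensures.seq (T := 1) (T' := 2) (ensures_setNat
    (Program.Ensures.seq (T := 1) (T' := 1) (ensures_setNat (ensures_setNat ?_))))
  refine ⟨rfl, fun a ha => ?_, fun i j => ?_⟩
  · funext e
    simp only [writeNat_nat]
    rw [if_neg (by omega), if_neg (by omega), if_neg (by omega)]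
  · simp only [Listed, writeNat_nat, NExp.eval]
    simp only [zero_ne_one, OfNat.ofNat_ne_one, OfNat.zero_ne_ofNat, OfNat.one_ne_ofNat,
      OfNat.ofNat_ne_zero, one_ne_zero, false_and, true_and, and_self, if_true, if_false]
    constructor
    · rintro ⟨e, he, h1, h2⟩
      by_cases hee : e = m.nat 0 0
      · rw [if_pos hee] at h1 h2
        exact Or.inr ⟨h1.symm, h2.symm⟩
      · rw [if_neg hee] at h1 h2
        exact Or.inl ⟨e, by omega, h1, h2⟩
    · rintro (⟨e, he, h1, h2⟩ | ⟨h1, h2⟩)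
      · exact ⟨e, by omega, by rwa [if_neg he.ne], by rwa [if_neg he.ne]⟩
      · exact ⟨m.nat 0 0, by omega, by rw [if_pos rfl, h1], by rw [if_pos rfl, h2]⟩

/-- Pairs are listed in both orders and with i = j as well; `outputGraph` symmetrizes and discards
loops. The invariant of the inner loop is the full rows before k and an initial segment of row k. -/
theorem ensures_edgeProgram {m₀ m : Memory} {d n : ℕ} (K : ℕ) (h : HoldsInput m₀ d n m) :
    (edgeProgram d K).Ensures (n * (n * 6 + 4) + 3) m fun m' => ∀ i j, Listed m' i j ↔
      i < n ∧ j < n ∧ m₀.sqDist d i j ≤ (K : ℝ) ^ 2 * m.real (d + 1) i ∧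
        m₀.sqDist d i j ≤ (K : ℝ) ^ 2 * m.real (d + 1) j := by
  set P : ℕ → ℕ → Prop := fun i j => m₀.sqDist d i j ≤ (K : ℝ) ^ 2 * m.real (d + 1) i ∧
        m₀.sqDist d i j ≤ (K : ℝ) ^ 2 * m.real (d + 1) j with hP
  let I : ℕ → Memory → Prop := fun k m' => m'.nat 3 0 = n ∧ m'.real = m.real ∧
    ∀ i j, Listed m' i j ↔ i < k ∧ j < n ∧ P i j
  let J : ℕ → ℕ → Memory → Prop := fun k k' m' => m'.nat 3 0 = n ∧ m'.real = m.real ∧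
    m'.nat 4 0 = k ∧ ∀ i j, Listed m' i j ↔ i < k ∧ j < n ∧ P i j ∨ i = k ∧ j < k' ∧ P i j
  have hloop : (edgeProgram d K).Ensures (1 + (n * ((n * (4 + 2) + 2) + 2) + 2)) m
      (I (max 0 n)) := by
    refine Program.Ensures.seq (ensures_setNat ?_)
    refine ensures_forRange I (fun k m hm => hm.1) ?_ ?_
    · refine ⟨by simp [writeNat_nat, h.size], rfl, fun i j => ?_⟩
      rw [listed_writeNat (by omega)]
      simp [Listed, writeNat_nat, NExp.eval]
    · intro k m₁ hs hk hkm ⟨h1, h2, h3⟩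
      refine (ensures_forRange (J k) (fun k m hm => hm.1) ?_ ?_).mono le_rfl ?_
      · refine ⟨by simp [writeNat_nat, h1], h2, by simp [writeNat_nat, hkm], fun i j => ?_⟩
        rw [listed_writeNat (by omega), h3]
        simp
      · intro k' m₂ hs' hk' hkm' ⟨h4, h5, h6, h7⟩
        have hco : ∀ l < d, m₂.real l = m₀.real l := by rw [h5]; exact h.coord
        have htest : (edgeTest d K).Holds m₂ ↔ P k k' := by
          simp only [edgeTest, BExp.Holds, eval_sqDist hco, RExp.eval, NExp.eval, h6, hkm', h5, hP]
          push_cast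
          rfl
        refine ensures_ite (T := 3) (fun hb => (ensures_appendEdge m₂).mono le_rfl ?_)
          (fun hb => (ensures_skip ?_).mono (Q := fun m' => m'.nat 5 0 = k' ∧
            J k (k' + 1) (m'.writeNat 5 0 (k' + 1))) (by omega : 1 ≤ 3) fun _ => id)
        · rw [htest] at hb
          intro m₃ ⟨h8, h9, h10⟩
          refine ⟨by rw [h9 5 (by omega), hkm'], ?_, h8.trans h5, ?_, fun i j => ?_⟩
          · rw [writeNat_nat, if_neg (by omega), h9 3 le_rfl, h4]
          · rw [writeNat_nat, if_neg (by omega), h9 4 (by omega), h6]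
          · rw [listed_writeNat (by omega), h10, h7, h6, hkm']
            constructor
            · rintro ((h | ⟨h, h', h''⟩) | ⟨rfl, rfl⟩)
              exacts [Or.inl h, Or.inr ⟨h, by omega, h''⟩, Or.inr ⟨rfl, by omega, hb⟩]
            · rintro (h | ⟨h, h', h''⟩)
              · exact Or.inl (Or.inl h)
              · rcases Nat.lt_succ_iff_lt_or_eq.1 h' with h' | h'
                exacts [Or.inl (Or.inr ⟨h, h', h''⟩), Or.inr ⟨h, h'⟩]
        · rw [htest] at hb
          refine ⟨hkm', by rw [writeNat_nat, if_neg (by omega), h4], h5,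
            by rw [writeNat_nat, if_neg (by omega), h6], fun i j => ?_⟩
          rw [listed_writeNat (by omega), h7]
          constructor
          · rintro (h | ⟨h, h', h''⟩)
            exacts [Or.inl h, Or.inr ⟨h, by omega, h''⟩]
          · rintro (h | ⟨h, h', h''⟩)
            · exact Or.inl h
            · rcases Nat.lt_succ_iff_lt_or_eq.1 h' with h' | h'
              · exact Or.inr ⟨h, h', h''⟩
              · rw [h, h'] at h''
                exact absurd h'' hb
      · intro m₂ ⟨h4, h5, h6, h7⟩
        refine ⟨h6, by rw [writeNat_nat, if_neg (by omega), h4], h5, fun i j => ?_⟩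
        rw [listed_writeNat (by omega), h7, Nat.zero_max]
        constructor
        · rintro (⟨h, h', h''⟩ | ⟨h, h', h''⟩)
          exacts [⟨by omega, h', h''⟩, ⟨by omega, h', h''⟩]
        · rintro ⟨h, h', h''⟩
          rcases Nat.lt_succ_iff_lt_or_eq.1 h with h | h
          exacts [Or.inl ⟨h, h', h''⟩, Or.inr ⟨h, h', h''⟩]
  refine hloop.mono (by ring_nf; omega) fun m' ⟨_, _, h3⟩ => ?_
  rwa [Nat.zero_max] at h3

/-- Compute the net graph of a farthest-first traversal. -/
def spannerProgram (d K : ℕ) : Program :=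
  .seq (.setNat 3 (.lit 0) (.reg 0)) (.seq (greedyProgram d) (edgeProgram d K))

theorem exists_computes_netGraph {d n : ℕ} (K : ℕ) (p : Fin n ↪ EuclideanSpace ℝ (Fin d)) :
    ∃ ρ : Fin n → ℝ, IsNetRadius p ρ ∧
      Computes (spannerProgram d K) p (netGraph K p ρ) (n * (n * 14 + 16) + 9) := by
  set m₀ := inputMemory p
  have hD : ∀ i j : Fin n, m₀.sqDist d i j = dist (p i) (p j) ^ 2 := by
    intro i j
    rw [EuclideanSpace.dist_eq, Real.sq_sqrt (Finset.sum_nonneg fun l _ => sq_nonneg _),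
      Memory.sqDist, Finset.sum_range]
    refine Finset.sum_congr rfl fun l _ => ?_
    rw [Real.dist_eq, sq_abs, sq]
    simp [m₀, inputMemory]
  have hinj : ∀ i < n, ∀ j < n, i ≠ j → 0 < m₀.sqDist d i j := by
    intro i hi j hj hij
    have := hD ⟨i, hi⟩ ⟨j, hj⟩
    rw [this]
    have : 0 < dist (p ⟨i, hi⟩) (p ⟨j, hj⟩) :=
      dist_pos.2 fun h => hij (Fin.ext_iff.1 (p.injective h))
    positivity
  have hrun : (spannerProgram d K).Ensures (1 + ((n * (n * 8 + 12) + 5) + (n * (n * 6 + 4) + 3)))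
      m₀ fun m => ∃ L : ℕ → ℝ, IsNetRadius p (fun i => √(L i)) ∧ ∀ i j, Listed m i j ↔
        i < n ∧ j < n ∧ m₀.sqDist d i j ≤ (K : ℝ) ^ 2 * L i ∧
          m₀.sqDist d i j ≤ (K : ℝ) ^ 2 * L j := by
    -- Entry 0 of array 0 is n on input and the edge count on output, so n is first copied to
    -- register 3.
    refine Program.Ensures.seq (ensures_setNat (Program.Ensures.seq ?_))
    have h0 : HoldsInput m₀ d n (m₀.writeNat 3 0 n) := ⟨by simp [writeNat_nat], fun l _ => rfl⟩
    have e : NExp.eval m₀ (.reg 0) = n := by simp [NExp.eval, m₀, inputMemory]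
    rw [e]
    refine (ensures_greedyProgram h0 hinj).mono le_rfl fun m₁ ⟨h1, h2⟩ => ?_
    refine (ensures_edgeProgram K h1).mono le_rfl fun m₂ h3 => ⟨m₁.real (d + 1), ?_, h3⟩
    rcases Nat.eq_zero_or_pos n with hn | hn
    · subst hn
      exact ⟨fun i => i.elim0, fun i => i.elim0, fun _ i => i.elim0, fun i => i.elim0⟩
    · obtain ⟨C, hC, hCg⟩ := h2 hn
      exact hCg.isNetRadius hC p hD
  obtain ⟨m, t, h1, h2, L, h3, h4⟩ := hrun
  refine ⟨_, h3, m, t, h1, h2.trans (by ring_nf; omega), ?_⟩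
  -- Translates the root-free test of the program into the adjacency of `netGraph`.
  have hle : ∀ (x : ℝ) (i : Fin n), 0 ≤ x → (x ^ 2 ≤ (K : ℝ) ^ 2 * L i ↔ x ≤ K * √(L i)) := by
    intro x i hx
    have := (Real.sqrt_pos.1 (h3.pos_radius i)).le
    rw [← Real.sqrt_sq (by positivity : (0 : ℝ) ≤ K), ← Real.sqrt_mul (by positivity),
      Real.le_sqrt (by positivity), Real.sqrt_sq (by positivity)]
    positivity
  ext u v
  rw [outputGraph, SimpleGraph.fromRel_adj]
  change u ≠ v ∧ (Listed m u v ∨ Listed m v u) ↔ u ≠ v ∧ _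
  simp only [h4, hD, u.2, v.2, true_and, hle _ _ dist_nonneg, dist_comm (p v)]
  tauto

end RealRAM

/-! ### The main theorem -/

theorem theorem21 (d : ℕ) (hd : 2 ≤ d) (ε : ℝ) (hε0 : 0 < ε) (hε1 : ε ≤ 1) :
    ∃ (A : RealRAM.Program) (q : Polynomial ℕ) (C : ℝ)
      (G : ∀ n : ℕ, (Fin n ↪ EuclideanSpace ℝ (Fin d)) → SimpleGraph (Fin n)),
      (∀ (n : ℕ) (p : Fin n ↪ EuclideanSpace ℝ (Fin d)),
        RealRAM.Computes A p (G n p) (q.eval n) ∧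
        IsSpanner (1 + ε) p (G n p) ∧
        ((G n p).edgeSet.ncard : ℝ) ≤ C * n) ∧
      ∀ δ : ℝ, 0 < δ → δ ≤ d →
        ∀ F : Set (Finset (EuclideanSpace ℝ (Fin d))),
          fractalDim F ≤ δ → (1 ≤ δ → δ ∈ fractalExponents F) →
          ∃ K : ℝ, ∀ n : ℕ, 2 ≤ n → ∀ p : Fin n ↪ EuclideanSpace ℝ (Fin d),
            Finset.univ.map p ∈ F →
              (1 < δ → (pathwidth (G n p) : ℝ) ≤ K * ((n : ℝ) ^ (1 - 1 / δ) * Real.log n)) ∧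
              (δ = 1 → (pathwidth (G n p) : ℝ) ≤ K * Real.log n ^ 2) ∧
              (δ < 1 → (pathwidth (G n p) : ℝ) ≤ K * Real.log n) := by
  -- Replacing 1/ε by an integer N + 1 makes K an integer, hence a constant that a program may
  -- contain even if ε is irrational.
  obtain ⟨N, hN⟩ := exists_nat_one_div_lt hε0
  have hcast : ((16 * (N + 1) + 8 : ℕ) : ℝ) = 16 * ((N + 1 : ℕ) : ℝ) + 8 := by push_cast; ring
  choose ρ hρ hcomp using fun (n : ℕ) (p : Fin n ↪ EuclideanSpace ℝ (Fin d)) =>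
    RealRAM.exists_computes_netGraph (16 * (N + 1) + 8) p
  rw [hcast] at hcomp
  have hK : (1 : ℝ) ≤ 16 * ((N + 1 : ℕ) : ℝ) + 8 := by
    have : (0 : ℝ) ≤ ((N + 1 : ℕ) : ℝ) := Nat.cast_nonneg _
    linarith
  refine ⟨RealRAM.spannerProgram d (16 * (N + 1) + 8),
    .X * (.X * 14 + 16) + 9, (1 + 2 * (16 * ((N + 1 : ℕ) : ℝ) + 8)) ^ d,
    fun n p => netGraph (16 * ((N + 1 : ℕ) : ℝ) + 8) p (ρ n p), fun n p => ⟨?_, ?_, ?_⟩, ?_⟩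
  · simpa using hcomp n p
  · exact (hρ n p).isSpanner_netGraph N.succ_pos (by push_cast; exact hN.le)
  · have := (hρ n p).ncard_edgeSet_netGraph_le (by linarith :
      (0 : ℝ) ≤ 16 * ((N + 1 : ℕ) : ℝ) + 8)
    rwa [finrank_euclideanSpace_fin, Fintype.card_fin] at this
  · intro δ _ _ F hF hδ
    obtain ⟨B, hB⟩ := exists_pathwidth_bounds hK hF hδ
    exact ⟨B, fun n hn p hp => hB n hn p (ρ n p) (hρ n p) hp⟩
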